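/- All rings are associative with unit. A ring is left perfect if every left module over it has a projective cover. Let $\mathfrak R$ be a complete, separated topological ring with a base of neighborhoods of zero formed by open two-sided ideals, and suppose that for every open two-sided ideal $\mathfrak I\subset\mathfrak R$ the discrete quotient ring $\mathfrak R/\mathfrak I$ is left perfect. Assume that at least one of the following holds: (a) $\mathfrak R$ is commutative; (b) $\mathfrak R$ has a countable base of neighborhoods of zero; (c) there are only finitely many open two-sided ideals $\mathfrak I\subset\mathfrak R$ for which $\mathfrak R/\mathfrak I$ is semisimple Artinian. Let $H(R)$ denote the Jacobson radical of a ring $R$, and let $\mathfrak H=\varprojlim_{\mathfrak I}H(\mathfrak R/\mathfrak I)\subset\varprojlim_{\mathfrak I}\mathfrak R/\mathfrak I=\mathfrak R$, the limit being over all open two-sided ideals $\mathfrak I$; that is, $\mathfrak H$ consists of the elements of $\mathfrak R$ whose image in each $\mathfrak R/\mathfrak I$ lies in $H(\mathfrak R/\mathfrak I)$. Then: 1. $\mathfrak H$ is a two-sided ideal, and it is topologically left T-nilpotent: for every sequence $a_1,a_2,a_3,\dots$ in $\mathfrak H$, the sequence $a_1,\ a_1a_2,\ a_1a_2a_3,\dots$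 converges to zero in $\mathfrak R$. 2. $\mathfrak H$ is strongly closed in $\mathfrak R$: it is closed, the quotient $\mathfrak R/\mathfrak H$ is complete in the quotient topology, and for every set $X$ every family $(q_x)_{x\in X}$ in $\mathfrak R/\mathfrak H$ converging to zero (each neighborhood of zero contains $q_x$ for all but finitely many $x$) lifts to a family $(a_x)_{x\in X}$ in $\mathfrak R$ converging to zero. 3. $\mathfrak R/\mathfrak H$ with the quotient topology is isomorphic, as a topological ring, to a product $\prod_{\gamma\in\Gamma}S_\gamma$ of simple Artinian discrete rings with the product topology. 4. Suppose $\mathfrak R$ is commutative. Let $\Gamma$ be the set of open ideals $\mathfrak G\subset\mathfrak R$ such that $\mathfrak R/\mathfrak G$ is a field. For $\mathfrak G\in\Gamma$ let $\mathfrak R_{\mathfrak G}=\varprojlim_{\mathfrak J}\mathfrak R/\mathfrak J$ with the projective limit topology, the limit being over all open ideals $\mathfrak J\subset\mathfrak G$ for which $\mathfrak R/\mathfrak J$ is a local ring, and let $\mathfrak H_{\mathfrak G}$ be the kernel of the natural homomorphism $\mathfrak R_{\mathfrak G}\to\mathfrak R/\mathfrak G$. Then each $\mathfrak R_{\mathfrak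 G}$ is a local ring; the natural ring homomorphism $\mathfrak R\to\prod_{\mathfrak G\in\Gamma}\mathfrak R_{\mathfrak G}$ is an isomorphism of topological rings (for the product topology) and maps $\mathfrak H$ onto $\prod_{\mathfrak G\in\Gamma}\mathfrak H_{\mathfrak G}$; and the natural maps $\mathfrak R/\mathfrak H\to\mathfrak R/\mathfrak G$ induce an isomorphism of topological rings $\mathfrak R/\mathfrak H\cong\prod_{\mathfrak G\in\Gamma}\mathfrak R/\mathfrak G$, where the fields $\mathfrak R/\mathfrak G$ are discrete. -/

import Mathlib

open Filter Topology

universe w u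

/-- A projective cover in the category of left `R`-modules: an epimorphism `p : P → M` with `P`
projective such that every endomorphism `e` of `P` with `p ∘ e = p` is an automorphism. -/
def IsProjectiveCover {R : Type u} [Ring R] {P M : Type u} [AddCommGroup P] [Module R P]
    [AddCommGroup M] [Module R M] (p : P →ₗ[R] M) : Prop :=
  Module.Projective R P ∧ Function.Surjective p ∧
    ∀ e : P →ₗ[R] P, p ∘ₗ e = p → Function.Bijective e

/-- A ring is left perfect if every left module over it has a projective cover. -/
def IsLeftPerfect (R : Type u) [Ring R] : Prop :=
  ∀ (M : Type u) [AddCommGroup M] [Module R M],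
    ∃ (P : Type u) (_ : AddCommGroup P) (_ : Module R P) (p : P →ₗ[R] M), IsProjectiveCover p

/-- A closed subgroup `H` of a (complete, separated) topological abelian group `A` is strongly
closed if `A ⧸ H` is complete in the quotient topology and every family of elements of `A ⧸ H`
converging to zero lifts to a family of elements of `A` converging to zero, that is, the induced
map `A[[X]] → (A ⧸ H)[[X]]` is surjective for every set `X`. A family `(a x)` converges to zero
if every neighborhood of zero contains `a x` for all but finitely many `x`. -/
structure IsStronglyClosed {A : Type u} [AddCommGroup A] [TopologicalSpace A]
    [IsTopologicalAddGroup A] (H : AddSubgroup A) : Prop where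
  isClosed : IsClosed (H : Set A)
  complete : @CompleteSpace (A ⧸ H) (IsTopologicalAddGroup.rightUniformSpace (A ⧸ H))
  exists_lift : ∀ (X : Type w) (q : X → A ⧸ H), Tendsto q cofinite (𝓝 0) →
    ∃ a : X → A, Tendsto a cofinite (𝓝 0) ∧ ∀ x, (a x : A ⧸ H) = q x

/-- Left T-nilpotency in the topological sense: for every sequence `a₀, a₁, a₂, …` in `H`, the
products `a₀, a₀ a₁, a₀ a₁ a₂, …` converge to zero. -/
def IsTopologicallyLeftTNilpotent {R : Type u} [Ring R] [TopologicalSpace R] (H : Ideal R) :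
    Prop :=
  ∀ a : ℕ → R, (∀ n, a n ∈ H) →
    Tendsto (fun n : ℕ => ((List.range (n + 1)).map a).prod) atTop (𝓝 0)

/-- The open two-sided ideals `I` of a topological ring; the discrete quotient rings of `R` are
the rings `R ⧸ I`. -/
abbrev OpenIdeal (R : Type u) [Ring R] [TopologicalSpace R] : Type u :=
  {I : Ideal R // I.IsTwoSided ∧ IsOpen (I : Set R)}

instance OpenIdeal.isTwoSided {R : Type u} [Ring R] [TopologicalSpace R] (I : OpenIdeal R) :
    I.1.IsTwoSided := I.2.1

/-- The projective limit of the Jacobson radicals of the discrete quotient rings `R ⧸ I`, as a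
subset of `R = lim R ⧸ I`: the elements whose image in every `R ⧸ I` lies in the Jacobson radical
of `R ⧸ I`. -/
def limJacobson (R : Type u) [Ring R] [TopologicalSpace R] : Ideal R :=
  ⨅ I : OpenIdeal R, (Ring.jacobson (R ⧸ I.1)).comap (Ideal.Quotient.mk I.1)

instance limJacobson.isTwoSided (R : Type u) [Ring R] [TopologicalSpace R] :
    (limJacobson R).IsTwoSided := by
  unfold limJacobson; infer_instance

/-- The open ideals `G` such that `R ⧸ G` is a field. -/
abbrev OpenFieldIdeal (R : Type u) [Ring R] [TopologicalSpace R] : Type u :=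
  {G : OpenIdeal R // IsField (R ⧸ G.1)}

/-- The open ideals `J ⊆ G` such that `R ⧸ J` is a local ring. -/
abbrev OpenLocalIdeal {R : Type u} [Ring R] [TopologicalSpace R] (G : OpenFieldIdeal R) : Type u :=
  {J : OpenIdeal R // IsLocalRing (R ⧸ J.1) ∧ J.1 ≤ G.1.1}

theorem isLocalRing_of_isField_aux {K : Type u} [Ring K] (h : IsField K) : IsLocalRing K :=
  letI := h.toField
  inferInstanceAs (IsLocalRing K)

/-- `G` itself, as an open ideal contained in `G` with local quotient. -/
def OpenLocalIdeal.self {R : Type u} [Ring R] [TopologicalSpace R] (G : OpenFieldIdeal R) :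
    OpenLocalIdeal G :=
  ⟨G.1, isLocalRing_of_isField_aux G.2, le_rfl⟩

/-- The projective limit `R_G` of the discrete local rings `R ⧸ J` over the open ideals `J ⊆ G`
with `R ⧸ J` local, with the projective limit topology (induced from the product). -/
def LocalPiece {R : Type u} [Ring R] [TopologicalSpace R] (G : OpenFieldIdeal R) :
    Subring (∀ J : OpenLocalIdeal G, R ⧸ J.1.1) where
  carrier := {x | ∀ (J J' : OpenLocalIdeal G) (h : J.1.1 ≤ J'.1.1),
    Ideal.Quotient.factor h (x J) = x J'}
  mul_mem' hx hy J J' h := by simp [hx J J' h, hy J J' h]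
  one_mem' J J' h := by simp
  add_mem' hx hy J J' h := by simp [hx J J' h, hy J J' h]
  zero_mem' J J' h := by simp
  neg_mem' hx J J' h := by simp [hx J J' h]

/-- The natural ring homomorphism `R → R_G`. -/
def toLocalPiece {R : Type u} [Ring R] [TopologicalSpace R] (G : OpenFieldIdeal R) :
    R →+* LocalPiece G :=
  (RingHom.pi fun J : OpenLocalIdeal G => Ideal.Quotient.mk J.1.1).codRestrict (LocalPiece G)
    (fun _ _ _ h => Ideal.Quotient.factor_mk h _)

/-- The kernel `H_G` of the natural ring homomorphism `R_G → R ⧸ G`. -/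
def LocalPiece.residueKernel {R : Type u} [Ring R] [TopologicalSpace R] (G : OpenFieldIdeal R) :
    Ideal (LocalPiece G) :=
  RingHom.ker
    ((Pi.evalRingHom (fun J : OpenLocalIdeal G => R ⧸ J.1.1) (OpenLocalIdeal.self G)).comp
      (LocalPiece G).subtype)

/-- The natural ring homomorphism from `R` to the product of the rings `R_G` over all open ideals
`G` such that `R ⧸ G` is a field. -/
def toLocalPieces (R : Type u) [Ring R] [TopologicalSpace R] :
    R →+* ∀ G : OpenFieldIdeal R, LocalPiece G :=
  RingHom.pi fun G => toLocalPiece G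

/-! Write rad I for the preimage in `R` of the Jacobson radical of `R ⧸ I`. By Bass's arguments, a
left perfect ring has a left T-nilpotent radical with semisimple quotient: kernels of projective
covers are superfluous, and a module `M` with `J M = M` vanishes. Hence T-nilpotency of `limJacobson
R` can be checked modulo each open `I`, and `R ⧸ rad I` is a finite product of the simple Artinian
rings `R ⧸ G` with `G ⊇ I` open. So `limJacobson R` is the intersection of all such `G`.

What remains is an exactness question for projective limits, isolated in two properties.
`LiftsCompatibleFamilies` says that `R` maps onto `lim R ⧸ rad I`, even with a prescribed value
modulo one open ideal; with the Chinese remainder theorem it identifies `R ⧸ limJacobson R`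
topologically with `∏ R ⧸ G`, hence gives completeness. `LiftsNullFamilies` gives the lifting of
null families.

The alternatives (a), (b), (c) serve to prove these two properties. With a countable base, rad I
surjects onto rad J modulo `J` for `I ≤ J`, and a Mittag-Leffler recursion along a decreasing
sequence works. In the finite case `limJacobson R` is itself open. In the commutative case each `R ⧸
I` is the product of its localizations at the finitely many maximal `G ⊇ I`, since its radical is
nil; passing to the limit, `R = ∏ R_G`, and families are lifted component by component. -/

/-! ### Left perfect rings -/

section Perfect

variable {R : Type u} [Ring R]

/-- Since `p` restricted to `L` is still onto, `p` lifts through it; the lift, seen as an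
endomorphism of `P` over `M`, is bijective and has image in `L`. Thus the kernel of a projective
cover is superfluous. -/
theorem IsProjectiveCover.eq_top_of_sup_ker {P M : Type u} [AddCommGroup P] [Module R P]
    [AddCommGroup M] [Module R M] {p : P →ₗ[R] M} (hp : IsProjectiveCover p)
    (L : Submodule R P) (hL : L ⊔ LinearMap.ker p = ⊤) : L = ⊤ := by
  obtain ⟨hproj, hsurj, hend⟩ := hp
  have hs : Function.Surjective (p ∘ₗ L.subtype) := by
    intro m
    obtain ⟨x, rfl⟩ := hsurj m
    obtain ⟨l, hl, k, hk, rfl⟩ := Submodule.mem_sup.1 (hL ▸ Submodule.mem_top : x ∈ L ⊔ _)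
    exact ⟨⟨l, hl⟩, by simp [LinearMap.mem_ker.1 hk]⟩
  obtain ⟨e, he⟩ := Module.projective_lifting_property _ p hs
  have hb := hend (L.subtype ∘ₗ e) (by rw [← LinearMap.comp_assoc, he])
  rw [eq_top_iff]
  intro x _
  obtain ⟨y, rfl⟩ := hb.2 x
  exact (e y).2

theorem Submodule.eq_top_of_sup_map {P M : Type*} [AddCommGroup P] [Module R P]
    [AddCommGroup M] [Module R M] {K : Submodule R P} (hK : ∀ L, L ⊔ K = ⊤ → L = ⊤)
    (f : P →ₗ[R] M) (L : Submodule R M) (hL : L ⊔ K.map f = ⊤) : L = ⊤ := by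
  have h : L.comap f = ⊤ := by
    refine hK _ (eq_top_iff.2 fun x _ => ?_)
    obtain ⟨l, hl, _, ⟨k, hk, rfl⟩, h⟩ :=
      Submodule.mem_sup.1 (hL ▸ Submodule.mem_top : f x ∈ L ⊔ K.map f)
    refine Submodule.mem_sup.2 ⟨x - k, ?_, k, hk, by abel⟩
    rw [Submodule.mem_comap, map_sub, ← h, add_sub_cancel_right]
    exact hl
  rw [← hL, eq_comm, sup_eq_left]
  rintro _ ⟨k, -, rfl⟩
  exact (h ▸ Submodule.mem_top : k ∈ L.comap f)

theorem Ideal.le_jacobson_of_sup_eq_top {N : Ideal R} (hN : ∀ L, L ⊔ N = ⊤ → L = ⊤) :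
    N ≤ Ring.jacobson R := by
  rw [Ring.jacobson_eq_sInf_isMaximal]
  refine le_sInf fun m hm => ?_
  by_contra h
  have hm' : m.IsMaximal := hm
  exact hm'.ne_top (hN m (hm'.1.2 _ (left_lt_sup.2 h)))

/-- The projection `R → R ⧸ I` lifts to the cover `P` of `R ⧸ I`, and the lift is onto because the
kernel of the cover is superfluous. A section embeds `P` in `R` as `L`; then `I ⊓ L` lies in the
image of that kernel, a superfluous left ideal. -/
theorem IsLeftPerfect.exists_sup_eq_top (h : IsLeftPerfect R) (I : Ideal R) :
    ∃ L : Ideal R, I ⊔ L = ⊤ ∧ I ⊓ L ≤ Ring.jacobson R := by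
  obtain ⟨P, _, _, p, hp⟩ := h (R ⧸ I)
  have := hp.1
  obtain ⟨φ, hφ⟩ := Module.projective_lifting_property p I.mkQ hp.2.1
  have hφ' : ∀ x, p (φ x) = I.mkQ x := fun x => LinearMap.congr_fun hφ x
  have hφs : Function.Surjective φ := by
    rw [← LinearMap.range_eq_top]
    refine hp.eq_top_of_sup_ker _ (eq_top_iff.2 fun x _ => ?_)
    obtain ⟨r, hr⟩ := I.mkQ_surjective (p x)
    exact Submodule.mem_sup.2 ⟨φ r, ⟨r, rfl⟩, x - φ r, by simp [hφ', hr], by abel⟩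
  obtain ⟨s, hs⟩ := Module.projective_lifting_property φ LinearMap.id hφs
  have hs' : ∀ x, φ (s x) = x := fun x => LinearMap.congr_fun hs x
  refine ⟨LinearMap.range s, eq_top_iff.2 fun x _ => ?_, ?_⟩
  · refine Submodule.mem_sup.2 ⟨x - s (φ x), ?_, s (φ x), ⟨_, rfl⟩, by abel⟩
    rw [← Submodule.Quotient.mk_eq_zero, ← Submodule.mkQ_apply, ← hφ', map_sub, hs', sub_self,
      map_zero]
  · refine le_trans ?_ (Ideal.le_jacobson_of_sup_eq_top
      (Submodule.eq_top_of_sup_map hp.eq_top_of_sup_ker s))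
    rintro _ ⟨hI, y, rfl⟩
    refine ⟨y, ?_, rfl⟩
    rw [SetLike.mem_coe, LinearMap.mem_ker, ← hs' y, hφ', Submodule.mkQ_apply,
      Submodule.Quotient.mk_eq_zero]
    exact hI

theorem IsLeftPerfect.isSemisimpleRing (h : IsLeftPerfect R) :
    IsSemisimpleRing (R ⧸ Ring.jacobson R) := by
  refine (isSemisimpleModule_iff _ _).2 ⟨fun I => ?_⟩
  obtain ⟨L, hL, hL'⟩ := h.exists_sup_eq_top (Ideal.comap (Ideal.Quotient.mk _) I)
  have hsurj := Ideal.Quotient.mk_surjective (I := Ring.jacobson R)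
  refine ⟨Ideal.map (Ideal.Quotient.mk _) L, ?_, ?_⟩
  · rw [Submodule.disjoint_def]
    intro x hx hxL
    obtain ⟨l, hl, rfl⟩ := (Ideal.mem_map_iff_of_surjective _ hsurj).1 hxL
    exact Ideal.Quotient.eq_zero_iff_mem.2 (hL' ⟨hx, hl⟩)
  · rw [codisjoint_iff, Ideal.eq_top_iff_one]
    obtain ⟨i, hi, l, hl, hil⟩ := Submodule.mem_sup.1 ((Ideal.eq_top_iff_one _).1 hL)
    rw [← map_one (Ideal.Quotient.mk _), ← hil, map_add]
    exact Submodule.mem_sup.2 ⟨_, hi, _, Ideal.mem_map_of_mem _ hl, rfl⟩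

theorem Ring.exists_mul_one_sub_of_mem_jacobson {c : R} (hc : c ∈ Ring.jacobson R) :
    ∃ u, u * (1 - c) = 1 := by
  by_contra! h
  have hne : Ideal.span {1 - c} ≠ ⊤ := fun h' => by
    obtain ⟨u, hu⟩ := Ideal.mem_span_singleton'.1 ((Ideal.eq_top_iff_one _).1 h')
    exact h u hu
  obtain ⟨m, hm, hle⟩ := Ideal.exists_le_maximal _ hne
  refine hm.ne_top ((Ideal.eq_top_iff_one _).2 ?_)
  have h1 := add_mem (hle (Ideal.mem_span_singleton_self _)) (Ring.jacobson_le_of_isMaximal m hc)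
  rwa [sub_add_cancel] at h1

theorem Ring.exists_one_sub_mul_of_mem_jacobson {c : R} (hc : c ∈ Ring.jacobson R) :
    ∃ u, (1 - c) * u = 1 := by
  obtain ⟨u, hu⟩ := Ring.exists_mul_one_sub_of_mem_jacobson hc
  obtain ⟨v, hv⟩ := Ring.exists_mul_one_sub_of_mem_jacobson
    (neg_mem ((Ring.jacobson R).mul_mem_left u hc))
  have hu' : 1 - -(u * c) = u := by rw [mul_sub, mul_one] at hu; rw [← hu]; abel
  rw [hu'] at hv
  -- The left inverse `u` of `1 - c` has itself a left inverse `v`, which must equal `1 - c`.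
  exact ⟨u, by rw [← left_inv_eq_right_inv hv hu, hv]⟩

/-- A row vector fixed by right multiplication with a finite matrix over the radical is zero. -/
theorem eq_zero_of_eq_sum_mul_mem_jacobson {ι : Type*} (r : ι → R) (S : Finset ι)
    (c : ι → ι → R) (hc : ∀ i j, c i j ∈ Ring.jacobson R)
    (hr : ∀ j ∈ S, r j = ∑ i ∈ S, r i * c i j) : ∀ j ∈ S, r j = 0 := by
  classical
  induction S using Finset.induction_on generalizing c with
  | empty => simp
  | insert n S hn ih =>
    obtain ⟨u, hu⟩ := Ring.exists_one_sub_mul_of_mem_jacobson (hc n n)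
    -- Gaussian elimination: `1 - c n n` is invertible, so `r n` is expressed through the other
    -- entries; substituting it leaves a smaller matrix, still over the radical.
    have hrn : r n = ∑ i ∈ S, r i * (c i n * u) := by
      have h := hr n (Finset.mem_insert_self _ _)
      rw [Finset.sum_insert hn] at h
      have h' : r n * (1 - c n n) = ∑ i ∈ S, r i * c i n := by
        rw [mul_sub, mul_one, sub_eq_iff_eq_add']; exact h
      rw [← mul_one (r n), ← hu, ← mul_assoc, h', Finset.sum_mul]
      simp only [mul_assoc]
    have hS := ih (fun i j => c i n * u * c n j + c i j)
      (fun i j => add_mem ((Ring.jacobson R).mul_mem_left _ (hc n j)) (hc i j)) (by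
        intro j hj
        have h := hr j (Finset.mem_insert_of_mem hj)
        rw [Finset.sum_insert hn, hrn, Finset.sum_mul, ← Finset.sum_add_distrib] at h
        rw [h]
        exact Finset.sum_congr rfl fun i _ => by simp only [mul_add, mul_assoc])
    intro j hj
    rcases Finset.mem_insert.1 hj with rfl | hj
    · rw [hrn]
      exact Finset.sum_eq_zero fun i hi => by rw [hS i hi, zero_mul]
    · exact hS j hj

/-- Bass: a projective module equal to its product with the radical is zero. -/
theorem Module.Projective.subsingleton_of_jacobson_smul_eq_top {P : Type*} [AddCommGroup P]
    [Module R P] [Module.Projective R P]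
    (hP : Ring.jacobson R • (⊤ : Submodule R P) = ⊤) : Subsingleton P := by
  obtain ⟨s, hs⟩ := (Module.projective_def (R := R) (P := P)).1 inferInstance
  have hmem : ∀ x y, s x y ∈ Ring.jacobson R := by
    intro x y
    have hx : x ∈ Ring.jacobson R • (⊤ : Submodule R P) := by rw [hP]; trivial
    refine Submodule.smul_induction_on hx (fun a ha m _ => ?_) (fun a b ha hb => ?_)
    · rw [map_smul, Finsupp.smul_apply, smul_eq_mul]
      exact Ideal.mul_mem_right _ _ ha
    · rw [map_add, Finsupp.add_apply]
      exact add_mem ha hb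
  refine subsingleton_of_forall_eq 0 fun q => ?_
  -- With `s` a section into the free module on `P`, the coordinates of `s q` form a row vector
  -- fixed by the matrix `(s x y)`, whose entries lie in the radical by `hmem`.
  have hq : s q = ∑ x ∈ (s q).support, s q x • s x := by
    conv_lhs => rw [← hs q, Finsupp.linearCombination_apply, Finsupp.sum, map_sum]
    simp
  have h0 : s q = 0 := by
    ext y
    by_cases hy : y ∈ (s q).support
    · refine eq_zero_of_eq_sum_mul_mem_jacobson (s q) (s q).support (fun x y => s x y) hmem
        (fun j _ => ?_) y hy
      conv_lhs => rw [hq]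
      simp [Finsupp.finsetSum_apply]
    · simpa using hy
  rw [← hs q, h0, map_zero]

theorem IsLeftPerfect.subsingleton_of_jacobson_smul_eq_top (h : IsLeftPerfect R) {M : Type u}
    [AddCommGroup M] [Module R M] (hM : Ring.jacobson R • (⊤ : Submodule R M) = ⊤) :
    Subsingleton M := by
  obtain ⟨P, _, _, p, hp⟩ := h M
  have := hp.1
  have hP : Ring.jacobson R • (⊤ : Submodule R P) = ⊤ := by
    refine hp.eq_top_of_sup_ker _ (eq_top_iff.2 fun x _ => ?_)
    have hx : p x ∈ (Ring.jacobson R • (⊤ : Submodule R P)).map p := by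
      rw [Submodule.map_smul'', Submodule.map_top, LinearMap.range_eq_top.2 hp.2.1, hM]
      trivial
    obtain ⟨y, hy, hxy⟩ := hx
    exact Submodule.mem_sup.2 ⟨y, hy, x - y, by simp [hxy], by abel⟩
  have := Module.Projective.subsingleton_of_jacobson_smul_eq_top hP
  exact hp.2.1.subsingleton

/-- The Jacobson radical of a left perfect ring is left T-nilpotent. -/
theorem IsLeftPerfect.exists_prod_eq_zero (h : IsLeftPerfect R) (a : ℕ → R)
    (ha : ∀ n, a n ∈ Ring.jacobson R) :
    ∃ N, ∀ n ≥ N, ((List.range n).map a).prod = 0 := by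
  -- Bass's module: the colimit of `R → R → ⋯` under right multiplication by the `a n`. It equals
  -- its product with the radical, so it vanishes; the coefficients `r` writing the first basis
  -- vector through the relations are then the partial products, and only finitely many are nonzero.
  let y : ℕ → (ℕ →₀ R) := fun n => Finsupp.single n 1 - Finsupp.single (n + 1) (a n)
  let G : Submodule R (ℕ →₀ R) := Submodule.span R (Set.range y)
  have hM : Ring.jacobson R • (⊤ : Submodule R ((ℕ →₀ R) ⧸ G)) = ⊤ := by
    rw [eq_top_iff]
    rintro m -
    obtain ⟨f, rfl⟩ := G.mkQ_surjective m
    induction f using Finsupp.induction_linear with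
    | zero => simp
    | add f g hf hg => rw [map_add]; exact add_mem hf hg
    | single n r =>
      have h1 : (Finsupp.single n r : ℕ →₀ R) = r • Finsupp.single n 1 := by simp
      have h2 : G.mkQ (Finsupp.single n 1) = a n • G.mkQ (Finsupp.single (n + 1) 1) := by
        rw [← map_smul, ← sub_eq_zero, ← map_sub, Submodule.mkQ_apply,
          Submodule.Quotient.mk_eq_zero]
        refine Submodule.subset_span ⟨n, ?_⟩
        simp [y]
      rw [h1, map_smul, h2]
      exact Submodule.smul_mem _ _ (Submodule.smul_mem_smul (ha n) trivial)
  have hsub := h.subsingleton_of_jacobson_smul_eq_top hM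
  have h0 : Finsupp.single 0 1 ∈ G := by
    rw [← Submodule.Quotient.mk_eq_zero]
    exact Subsingleton.elim _ _
  obtain ⟨r, hr⟩ := (Finsupp.mem_span_range_iff_exists_finsupp).1 h0
  have hr0 : r 0 = 1 := by
    have := DFunLike.congr_fun hr 0
    simpa [Finsupp.sum, Finsupp.finsetSum_apply, y, Finsupp.single_apply] using this
  have hrs : ∀ n, r (n + 1) = r n * a n := by
    intro n
    have := DFunLike.congr_fun hr (n + 1)
    simp only [Finsupp.sum, Finsupp.finsetSum_apply, y, Finsupp.smul_apply, Finsupp.sub_apply,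
      smul_eq_mul, mul_sub, Finset.sum_sub_distrib, Finsupp.single_apply] at this
    simp at this
    rw [sub_eq_zero] at this
    rw [this]
    split_ifs with hn
    · rfl
    · rw [Finsupp.notMem_support_iff.1 hn, zero_mul]
  have hprod : ∀ n, ((List.range n).map a).prod = r n := by
    intro n
    induction n with
    | zero => simp [hr0]
    | succ n ih => rw [List.range_succ, List.map_append, List.prod_append, ih, hrs]; simp
  refine ⟨r.support.sup id + 1, fun n hn => ?_⟩
  rw [hprod]
  by_contra hne
  have := Finset.le_sup (f := id) (Finsupp.mem_support_iff.2 hne)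
  simp only [id] at this
  omega

end Perfect

/-! ### Two-sided ideals with simple or semisimple quotient -/

section Ideals

variable {R : Type u} [Ring R]

instance Ideal.isTwoSided_sup (I J : Ideal R) [I.IsTwoSided] [J.IsTwoSided] :
    (I ⊔ J).IsTwoSided := by
  refine ⟨fun {a} b ha => ?_⟩
  obtain ⟨x, hx, y, hy, rfl⟩ := Submodule.mem_sup.1 ha
  rw [add_mul]
  exact Submodule.add_mem_sup (I.mul_mem_right _ hx) (J.mul_mem_right _ hy)

/-- A noncommutative Chinese remainder theorem. -/
theorem Ideal.exists_sub_mem_of_pairwise_sup_eq_top {ι : Type*} (I : ι → Ideal R)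
    [∀ i, (I i).IsTwoSided] (hI : ∀ i j, i ≠ j → I i ⊔ I j = ⊤) (s : Finset ι) (x : ι → R) :
    ∃ r, ∀ i ∈ s, r - x i ∈ I i := by
  classical
  induction s using Finset.induction_on with
  | empty => exact ⟨0, by simp⟩
  | insert n s hn ih =>
    obtain ⟨r, hr⟩ := ih
    have htop : I n ⊔ ⨅ i ∈ s, I i = ⊤ :=
      Ideal.sup_iInf_eq_top fun i hi => hI _ _ fun h => hn (h ▸ hi)
    obtain ⟨u, hu, e, he, hue⟩ := Submodule.mem_sup.1 ((Ideal.eq_top_iff_one _).1 htop)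
    simp only [Submodule.mem_iInf] at he
    -- The element `e` is `1` modulo `I n` and `0` modulo the ideals already treated.
    refine ⟨r + (x n - r) * e, fun i hi => ?_⟩
    rcases Finset.mem_insert.1 hi with rfl | hi
    · have : r + (x i - r) * e - x i = -((x i - r) * u) := by
        rw [← eq_sub_iff_add_eq'] at hue
        rw [hue]; noncomm_ring
      rw [this]
      exact neg_mem ((I i).mul_mem_left _ hu)
    · rw [add_sub_right_comm]
      exact add_mem (hr i hi) ((I i).mul_mem_left _ (he i hi))

theorem Ideal.eq_or_eq_top_of_isSimpleRing {M N : Ideal R} [M.IsTwoSided] [N.IsTwoSided]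
    (hM : IsSimpleRing (R ⧸ M)) (h : M ≤ N) : N = M ∨ N = ⊤ := by
  rcases eq_bot_or_eq_top (Ideal.map (Ideal.Quotient.mk M) N).toTwoSided with h' | h'
  all_goals
    have h2 : ∀ x, x ∈ (Ideal.map (Ideal.Quotient.mk M) N).toTwoSided ↔ x ∈ Ideal.map _ N :=
      fun x => Ideal.mem_toTwoSided
    rw [h'] at h2
  · left
    refine le_antisymm (fun x hx => ?_) h
    exact Ideal.Quotient.eq_zero_iff_mem.1 ((TwoSidedIdeal.mem_bot _).1
      ((h2 _).2 (Ideal.mem_map_of_mem _ hx)))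
  · right
    rw [Ideal.eq_top_iff_one]
    have := (h2 (Ideal.Quotient.mk M 1)).1 trivial
    obtain ⟨y, hy, hxy⟩ := (Ideal.mem_map_iff_of_surjective _ Ideal.Quotient.mk_surjective).1 this
    have h3 := sub_mem hy (h (Ideal.Quotient.eq.1 hxy))
    rwa [sub_sub_cancel] at h3

theorem Ideal.ne_top_of_isSimpleRing {M : Ideal R} [M.IsTwoSided]
    (hM : IsSimpleRing (R ⧸ M)) : M ≠ ⊤ :=
  Ideal.Quotient.nontrivial_iff.1 inferInstance

theorem Ideal.sup_eq_top_of_isSimpleRing {M N : Ideal R} [M.IsTwoSided] [N.IsTwoSided]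
    (hM : IsSimpleRing (R ⧸ M)) (hN : IsSimpleRing (R ⧸ N)) (h : M ≠ N) : M ⊔ N = ⊤ := by
  rcases Ideal.eq_or_eq_top_of_isSimpleRing hM (le_sup_left : M ≤ M ⊔ N) with h1 | h1
  · rcases Ideal.eq_or_eq_top_of_isSimpleRing hN (le_sup_right : N ≤ M ⊔ N) with h2 | h2
    · exact absurd (h1.symm.trans h2) h
    · exact h2
  · exact h1

/-- A two-sided ideal with semisimple quotient is a finite intersection of two-sided ideals with
simple Artinian quotients. -/
theorem Ideal.exists_eq_iInf_isSimpleRing (N : Ideal R) [N.IsTwoSided]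
    (hN : IsSemisimpleRing (R ⧸ N)) :
    ∃ (n : ℕ) (M : Fin n → Ideal R) (_ : ∀ i, (M i).IsTwoSided),
      (∀ i, IsSimpleRing (R ⧸ M i) ∧ IsArtinianRing (R ⧸ M i)) ∧ N = ⨅ i, M i := by
  obtain ⟨n, D, d, _, _, ⟨e⟩⟩ := IsSemisimpleRing.exists_ringEquiv_pi_matrix_divisionRing (R ⧸ N)
  let f : ∀ i, R →+* Matrix (Fin (d i)) (Fin (d i)) (D i) := fun i =>
    ((Pi.evalRingHom _ i).comp e.toRingHom).comp (Ideal.Quotient.mk N)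
  have hf : ∀ i, Function.Surjective (f i) := fun i =>
    ((Function.surjective_eval i).comp e.surjective).comp Ideal.Quotient.mk_surjective
  refine ⟨n, fun i => RingHom.ker (f i), fun i => inferInstance, fun i => ?_, ?_⟩
  · let g := RingHom.quotientKerEquivOfSurjective (hf i)
    exact ⟨IsSimpleRing.of_ringEquiv g.symm inferInstance,
      g.symm.surjective.isArtinianRing⟩
  · ext x
    simp only [Submodule.mem_iInf, RingHom.mem_ker]
    rw [← Ideal.Quotient.eq_zero_iff_mem, ← map_eq_zero_iff e e.injective, funext_iff]
    rfl

/-- Two-sided ideals with simple quotients are equal or comaximal, and an ideal comaximal with every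
`M i` is comaximal with their intersection. -/
theorem Ideal.exists_le_of_iInf_le_isSimpleRing {n : ℕ} {M : Fin n → Ideal R}
    [∀ i, (M i).IsTwoSided] (hM : ∀ i, IsSimpleRing (R ⧸ M i)) {G : Ideal R} [G.IsTwoSided]
    (hG : IsSimpleRing (R ⧸ G)) (h : ⨅ i, M i ≤ G) : ∃ i, G = M i := by
  by_contra! hne
  have := Ideal.sup_iInf_eq_top (I := G) (J := M) (s := Finset.univ)
    fun i _ => Ideal.sup_eq_top_of_isSimpleRing hG (hM i) (hne i)
  simp only [Finset.mem_univ, iInf_true] at this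
  rw [sup_eq_left.2 h] at this
  exact Ideal.ne_top_of_isSimpleRing hG this

/-- The preimage in `R` of the Jacobson radical of `R ⧸ I`. -/
def Ideal.radicalOver (I : Ideal R) [I.IsTwoSided] : Ideal R :=
  (Ring.jacobson (R ⧸ I)).comap (Ideal.Quotient.mk I)

instance (I : Ideal R) [I.IsTwoSided] : I.radicalOver.IsTwoSided := by
  unfold Ideal.radicalOver; infer_instance

theorem Ideal.le_radicalOver (I : Ideal R) [I.IsTwoSided] : I ≤ I.radicalOver := fun x hx => by
  rw [Ideal.radicalOver, Ideal.mem_comap, Ideal.Quotient.eq_zero_iff_mem.2 hx]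
  exact zero_mem _

theorem Ideal.radicalOver_mono {I J : Ideal R} [I.IsTwoSided] [J.IsTwoSided] (h : I ≤ J) :
    I.radicalOver ≤ J.radicalOver := by
  intro x hx
  have : RingHomSurjective (Ideal.Quotient.factor h) := ⟨Ideal.Quotient.factor_surjective h⟩
  exact Ring.le_comap_jacobson (Ideal.Quotient.factor h) hx

theorem Ideal.radicalOver_eq_self {I : Ideal R} [I.IsTwoSided] (h : IsSemisimpleRing (R ⧸ I)) :
    I.radicalOver = I := by
  rw [Ideal.radicalOver, IsSemisimpleRing.jacobson_eq_bot, ← RingHom.ker_eq_comap_bot,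
    Ideal.mk_ker]

theorem Ideal.isSemisimpleRing_quotient_radicalOver (I : Ideal R) [I.IsTwoSided]
    (h : IsLeftPerfect (R ⧸ I)) : IsSemisimpleRing (R ⧸ I.radicalOver) := by
  have := h.isSemisimpleRing
  let f : R →+* (R ⧸ I) ⧸ Ring.jacobson (R ⧸ I) :=
    (Ideal.Quotient.mk _).comp (Ideal.Quotient.mk I)
  have hf : Function.Surjective f :=
    Ideal.Quotient.mk_surjective.comp Ideal.Quotient.mk_surjective
  have hk : RingHom.ker f = I.radicalOver := by
    rw [← RingHom.comap_ker, Ideal.mk_ker]; rfl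
  exact ((RingHom.quotientKerEquivOfSurjective hf).symm.trans
    (Ideal.quotEquivOfEq hk)).isSemisimpleRing

/-- The quotient by the sum is an image of the semisimple ring `R ⧸ I.radicalOver`, so it has no
radical. Hence the radical of `R ⧸ I` maps onto that of `R ⧸ J`, the surjectivity needed for passing
to limits. -/
theorem Ideal.radicalOver_eq_sup {I J : Ideal R} [I.IsTwoSided] [J.IsTwoSided] (hIJ : I ≤ J)
    (h : IsLeftPerfect (R ⧸ I)) : J.radicalOver = I.radicalOver ⊔ J := by
  refine le_antisymm ?_ (sup_le (Ideal.radicalOver_mono hIJ) J.le_radicalOver)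
  have hs := I.isSemisimpleRing_quotient_radicalOver h
  have := (Ideal.Quotient.factor
    (le_sup_left : I.radicalOver ≤ I.radicalOver ⊔ J)).isSemisimpleRing_of_surjective
    (Ideal.Quotient.factor_surjective _)
  rw [← Ideal.radicalOver_eq_self this]
  exact Ideal.radicalOver_mono le_sup_right

end Ideals

/-! ### Open ideals of a topological ring -/

section OpenIdeals

variable {R : Type u} [Ring R] [TopologicalSpace R]

theorem mem_limJacobson {x : R} :
    x ∈ limJacobson R ↔ ∀ I : OpenIdeal R, x ∈ I.1.radicalOver :=
  Submodule.mem_iInf _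

variable (R) in
/-- The unit ideal as an open ideal. -/
def OpenIdeal.top : OpenIdeal R := ⟨⊤, inferInstance, isOpen_univ⟩

instance (I J : Ideal R) [I.IsTwoSided] [J.IsTwoSided] : (I ⊓ J).IsTwoSided :=
  ⟨fun _ ha => ⟨I.mul_mem_right _ ha.1, J.mul_mem_right _ ha.2⟩⟩

/-- The intersection of two open ideals. -/
def OpenIdeal.inf (I J : OpenIdeal R) : OpenIdeal R :=
  ⟨I.1 ⊓ J.1, inferInstance, I.2.2.inter J.2.2⟩

/-- The quotient ring by an open ideal is simple Artinian. -/
def OpenIdeal.IsSimpleArtinian (I : OpenIdeal R) : Prop :=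
  IsSimpleRing (R ⧸ I.1) ∧ IsArtinianRing (R ⧸ I.1)

theorem OpenIdeal.IsSimpleArtinian.isSemisimpleRing {I : OpenIdeal R} (h : I.IsSimpleArtinian) :
    IsSemisimpleRing (R ⧸ I.1) :=
  have := h.1
  IsSimpleRing.isSemisimpleRing_iff_isArtinianRing.2 h.2

theorem OpenIdeal.IsSimpleArtinian.radicalOver_eq {I : OpenIdeal R} (h : I.IsSimpleArtinian) :
    I.1.radicalOver = I.1 :=
  Ideal.radicalOver_eq_self h.isSemisimpleRing

variable (R) in
/-- Families compatible modulo the radicals of the discrete quotients lift, with a prescribed value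
modulo one open ideal. -/
def LiftsCompatibleFamilies : Prop :=
  ∀ y : OpenIdeal R → R, (∀ I J : OpenIdeal R, I.1 ≤ J.1 → y I - y J ∈ J.1.radicalOver) →
    ∀ (K : OpenIdeal R) (a : R), a - y K ∈ K.1.radicalOver →
      ∃ r, r - a ∈ K.1 ∧ ∀ I : OpenIdeal R, r - y I ∈ I.1.radicalOver

variable (R) in
/-- Families converging to zero modulo the radicals of the discrete quotients can be changed by
elements of `limJacobson R` to families converging to zero. -/
def LiftsNullFamilies : Prop :=
  ∀ (X : Type w) (q : X → R), (∀ I : OpenIdeal R, {x | q x ∉ I.1.radicalOver}.Finite) →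
    ∃ a : X → R, (∀ x, a x - q x ∈ limJacobson R) ∧ ∀ I : OpenIdeal R, {x | a x ∉ I.1}.Finite

/-- Applying the property to the zero family shows that `limJacobson R` maps onto the radical of
each `R ⧸ I`. -/
theorem LiftsCompatibleFamilies.exists_sub_mem (hL : LiftsCompatibleFamilies R) (I : OpenIdeal R)
    {a : R} (ha : a ∈ I.1.radicalOver) : ∃ r ∈ limJacobson R, r - a ∈ I.1 := by
  obtain ⟨r, hr, h⟩ := hL (fun _ => 0) (fun I J _ => by simp) I a (by simpa using ha)
  exact ⟨r, mem_limJacobson.2 fun I => by simpa using h I, hr⟩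

/-! ### Simple Artinian discrete quotients -/

section Structure

variable [IsTopologicalRing R]

/-- An ideal containing an open ideal is open. -/
theorem OpenIdeal.isOpen_of_le (I : OpenIdeal R) {J : Ideal R} (h : I.1 ≤ J) :
    IsOpen (J : Set R) :=
  AddSubgroup.isOpen_mono (H₁ := I.1.toAddSubgroup) (H₂ := J.toAddSubgroup) h I.2.2

/-- The radical over an open ideal, as an open ideal. -/
def OpenIdeal.radical (I : OpenIdeal R) : OpenIdeal R :=
  ⟨I.1.radicalOver, inferInstance, I.isOpen_of_le I.1.le_radicalOver⟩

theorem OpenIdeal.isClosed (I : OpenIdeal R) : IsClosed (I.1 : Set R) :=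
  AddSubgroup.isClosed_of_isOpen I.1.toAddSubgroup I.2.2

theorem OpenIdeal.discreteTopology (I : OpenIdeal R) : DiscreteTopology (R ⧸ I.1) :=
  QuotientAddGroup.discreteTopology (N := I.1.toAddSubgroup) I.2.2

/-- The predicate `P` allows both `OpenIdeal.IsSimpleArtinian` and, for commutative rings, the
condition that the quotient be a field. A simple Artinian `G ⊇ I` contains `I.radicalOver`, so it is
one of the finitely many factors. -/
theorem OpenIdeal.exists_radicalOver_eq_iInf
    (hperf : ∀ I : OpenIdeal R, IsLeftPerfect (R ⧸ I.1))
    {P : OpenIdeal R → Prop} (hP : ∀ I, P I ↔ I.IsSimpleArtinian)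
    (I : OpenIdeal R) :
    ∃ (n : ℕ) (M : Fin n → {G : OpenIdeal R // P G}),
      I.1.radicalOver = ⨅ i, (M i).1.1 ∧
      ∀ G : {G : OpenIdeal R // P G}, I.1 ≤ G.1.1 → ∃ i, G = M i := by
  obtain ⟨n, M, hM2, hM, hI⟩ :=
    Ideal.exists_eq_iInf_isSimpleRing _ (I.1.isSemisimpleRing_quotient_radicalOver (hperf I))
  have hle : ∀ i, I.1 ≤ M i := fun i => I.1.le_radicalOver.trans (hI ▸ iInf_le _ i)
  let M' : Fin n → {G : OpenIdeal R // P G} := fun i =>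
    ⟨⟨M i, hM2 i, I.isOpen_of_le (hle i)⟩, (hP _).2 (hM i)⟩
  refine ⟨n, M', hI, fun G hG => ?_⟩
  have hGP := (hP _).1 G.2
  have h : ⨅ i, M i ≤ G.1.1 := by
    rw [← hI, ← hGP.radicalOver_eq]
    exact Ideal.radicalOver_mono hG
  obtain ⟨i, hi⟩ := Ideal.exists_le_of_iInf_le_isSimpleRing (fun i => (hM i).1) hGP.1 h
  exact ⟨i, Subtype.ext (Subtype.ext hi)⟩

theorem OpenIdeal.finite_ge
    (hperf : ∀ I : OpenIdeal R, IsLeftPerfect (R ⧸ I.1))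
    {P : OpenIdeal R → Prop} (hP : ∀ I, P I ↔ I.IsSimpleArtinian)
    (I : OpenIdeal R) :
    {G : {G : OpenIdeal R // P G} | I.1 ≤ G.1.1}.Finite := by
  obtain ⟨n, M, -, hM⟩ := I.exists_radicalOver_eq_iInf hperf hP
  refine (Set.finite_range M).subset fun G hG => ?_
  obtain ⟨i, rfl⟩ := hM G hG
  exact ⟨i, rfl⟩

theorem OpenIdeal.mem_radicalOver_iff
    (hperf : ∀ I : OpenIdeal R, IsLeftPerfect (R ⧸ I.1))
    {P : OpenIdeal R → Prop} (hP : ∀ I, P I ↔ I.IsSimpleArtinian)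
    (I : OpenIdeal R) {x : R} :
    x ∈ I.1.radicalOver ↔ ∀ G : {G : OpenIdeal R // P G}, I.1 ≤ G.1.1 → x ∈ G.1.1 := by
  obtain ⟨n, M, hI, hM⟩ := I.exists_radicalOver_eq_iInf hperf hP
  constructor
  · intro hx G hG
    rw [← ((hP _).1 G.2).radicalOver_eq]
    exact Ideal.radicalOver_mono hG hx
  · intro h
    rw [hI, Submodule.mem_iInf]
    exact fun i => h _ (I.1.le_radicalOver.trans (hI ▸ iInf_le _ i))

theorem mem_limJacobson_iff_forall_mem
    (hperf : ∀ I : OpenIdeal R, IsLeftPerfect (R ⧸ I.1))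
    {P : OpenIdeal R → Prop} (hP : ∀ I, P I ↔ I.IsSimpleArtinian)
    {x : R} :
    x ∈ limJacobson R ↔ ∀ G : {G : OpenIdeal R // P G}, x ∈ G.1.1 := by
  rw [mem_limJacobson]
  constructor
  · intro h G
    rw [← ((hP _).1 G.2).radicalOver_eq]
    exact h G.1
  · exact fun h I => (I.mem_radicalOver_iff hperf hP).2 fun G _ => h G

theorem OpenIdeal.exists_sub_mem
    (hperf : ∀ I : OpenIdeal R, IsLeftPerfect (R ⧸ I.1))
    {P : OpenIdeal R → Prop} (hP : ∀ I, P I ↔ I.IsSimpleArtinian)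
    (I : OpenIdeal R) (x : {G : OpenIdeal R // P G} → R) :
    ∃ r, ∀ G : {G : OpenIdeal R // P G}, I.1 ≤ G.1.1 → r - x G ∈ G.1.1 := by
  obtain ⟨r, hr⟩ := Ideal.exists_sub_mem_of_pairwise_sup_eq_top
    (fun G : {G : OpenIdeal R // P G} => G.1.1)
    (fun G G' h => Ideal.sup_eq_top_of_isSimpleRing ((hP _).1 G.2).1 ((hP _).1 G'.2).1
      fun h' => h (Subtype.ext (Subtype.ext h'))) (I.finite_ge hperf hP).toFinset x
  exact ⟨r, fun G hG => hr G (by simpa using hG)⟩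

theorem LiftsCompatibleFamilies.pi_mk_surjective
    (hperf : ∀ I : OpenIdeal R, IsLeftPerfect (R ⧸ I.1))
    {P : OpenIdeal R → Prop} (hP : ∀ I, P I ↔ I.IsSimpleArtinian)
    (hL : LiftsCompatibleFamilies R) :
    Function.Surjective
      (RingHom.pi fun G : {G : OpenIdeal R // P G} => Ideal.Quotient.mk G.1.1) := by
  intro x
  choose z hz using fun G => Ideal.Quotient.mk_surjective (x G)
  choose y hy using fun I : OpenIdeal R => I.exists_sub_mem hperf hP z
  have hc : ∀ I J : OpenIdeal R, I.1 ≤ J.1 → y I - y J ∈ J.1.radicalOver := by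
    intro I J hIJ
    refine (J.mem_radicalOver_iff hperf hP).2 fun G hG => ?_
    rw [← sub_sub_sub_cancel_right _ _ (z G)]
    exact sub_mem (hy I G (hIJ.trans hG)) (hy J G hG)
  -- No value needs to be prescribed here; modulo the unit ideal the condition is empty.
  obtain ⟨r, -, hr⟩ := hL y hc (OpenIdeal.top R) (y _)
    (by rw [sub_self]; exact zero_mem _)
  refine ⟨r, funext fun G => ?_⟩
  have h1 := hr G.1
  rw [((hP _).1 G.2).radicalOver_eq] at h1
  have h2 := add_mem h1 (hy G.1 G le_rfl)
  rw [sub_add_sub_cancel] at h2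
  exact (Ideal.Quotient.eq.2 h2).trans (hz G)

end Structure

end OpenIdeals

/-! ### The quotient by the limit radical as a topological product -/

section Homeomorph

/-- A surjective additive homomorphism mapping neighborhoods of zero to neighborhoods of zero is
open. -/
theorem AddMonoidHom.isOpenMap_of_image_mem_nhds {A B : Type*} [AddGroup A] [TopologicalSpace A]
    [IsTopologicalAddGroup A] [AddGroup B] [TopologicalSpace B] [IsTopologicalAddGroup B] (f : A →+ B)
    (h : ∀ U ∈ 𝓝 (0 : A), f '' U ∈ 𝓝 (0 : B)) : IsOpenMap f := by
  rw [isOpenMap_iff_nhds_le]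
  intro a
  rw [← map_add_left_nhds_zero (f a), ← map_add_left_nhds_zero a]
  intro s hs
  rw [mem_map, mem_map] at hs
  rw [mem_map]
  filter_upwards [h _ hs]
  rintro _ ⟨x, hx, rfl⟩
  have : f (a + x) ∈ s := hx
  rwa [map_add] at this

variable {R : Type u} [Ring R] [TopologicalSpace R] [IsTopologicalRing R]

/-- Only finitely many `G` contain `I`. If `r` vanishes in those coordinates, it lies in
`I.radicalOver`, and subtracting a suitable element of `limJacobson R`, which has image zero, moves
it into `I`. -/
theorem isOpenMap_pi_mk
    (hbase : ∀ U ∈ 𝓝 (0 : R), ∃ I : OpenIdeal R, (I.1 : Set R) ⊆ U)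
    (hperf : ∀ I : OpenIdeal R, IsLeftPerfect (R ⧸ I.1))
    {P : OpenIdeal R → Prop} (hP : ∀ I, P I ↔ I.IsSimpleArtinian)
    (hL : LiftsCompatibleFamilies R) :
    IsOpenMap (RingHom.pi fun G : {G : OpenIdeal R // P G} => Ideal.Quotient.mk G.1.1) := by
  have : ∀ G : {G : OpenIdeal R // P G}, DiscreteTopology (R ⧸ G.1.1) :=
    fun G => G.1.discreteTopology
  refine AddMonoidHom.isOpenMap_of_image_mem_nhds (RingHom.toAddMonoidHom
    (RingHom.pi fun G : {G : OpenIdeal R // P G} => Ideal.Quotient.mk G.1.1)) fun U hU => ?_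
  obtain ⟨I, hI⟩ := hbase U hU
  refine mem_of_superset (set_pi_mem_nhds (I.finite_ge hperf hP)
    (s := fun _ => {0}) fun G _ => by simp [nhds_discrete]) fun x hx => ?_
  obtain ⟨r, rfl⟩ := hL.pi_mk_surjective hperf hP x
  have hr : r ∈ I.1.radicalOver := (I.mem_radicalOver_iff hperf hP).2 fun G hG =>
    Ideal.Quotient.eq_zero_iff_mem.1 (hx G hG)
  obtain ⟨h, hh, hhr⟩ := hL.exists_sub_mem I hr
  refine ⟨r - h, hI ?_, funext fun G => ?_⟩
  · rw [← neg_sub]; exact neg_mem hhr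
  · refine Ideal.Quotient.eq.2 ?_
    rw [sub_sub_cancel_left]
    exact neg_mem ((mem_limJacobson_iff_forall_mem hperf hP).1 hh G)

theorem exists_ringEquiv_pi_isHomeomorph
    (hbase : ∀ U ∈ 𝓝 (0 : R), ∃ I : OpenIdeal R, (I.1 : Set R) ⊆ U)
    (hperf : ∀ I : OpenIdeal R, IsLeftPerfect (R ⧸ I.1))
    {P : OpenIdeal R → Prop} (hP : ∀ I, P I ↔ I.IsSimpleArtinian)
    (hL : LiftsCompatibleFamilies R) :
    ∃ e : (R ⧸ limJacobson R) ≃+* (∀ G : {G : OpenIdeal R // P G}, R ⧸ G.1.1),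
      IsHomeomorph e ∧ ∀ r G, e (Ideal.Quotient.mk _ r) G = Ideal.Quotient.mk G.1.1 r := by
  let f := RingHom.pi fun G : {G : OpenIdeal R // P G} => Ideal.Quotient.mk G.1.1
  have hf : Function.Surjective f := hL.pi_mk_surjective hperf hP
  have hmem : ∀ r, r ∈ limJacobson R ↔ f r = 0 := fun r => by
    rw [mem_limJacobson_iff_forall_mem hperf hP, funext_iff]
    exact forall_congr' fun G => Ideal.Quotient.eq_zero_iff_mem.symm
  let g := Ideal.Quotient.lift (limJacobson R) f fun r hr => (hmem r).1 hr
  have hg : Function.Bijective g := by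
    refine ⟨(injective_iff_map_eq_zero _).2 fun x hx => ?_, fun x => ?_⟩
    · obtain ⟨r, rfl⟩ := Ideal.Quotient.mk_surjective x
      exact Ideal.Quotient.eq_zero_iff_mem.2 ((hmem r).2 hx)
    · obtain ⟨r, rfl⟩ := hf x
      exact ⟨Ideal.Quotient.mk _ r, rfl⟩
  have hfc : Continuous f := continuous_pi fun G => continuous_quot_mk
  refine ⟨RingEquiv.ofBijective g hg, ⟨?_, ?_, hg⟩, fun r G => rfl⟩
  · exact continuous_quot_lift _ hfc
  · exact IsOpenMap.of_comp (f := Ideal.Quotient.mk (limJacobson R)) (g := g)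
      continuous_quot_mk Ideal.Quotient.mk_surjective (isOpenMap_pi_mk hbase hperf hP hL)

end Homeomorph

/-! ### Lifting under a countable base or finitely many semisimple quotients -/

section Lifting

variable {R : Type u} [Ring R]

/-- In a complete topological ring with a base of open ideals, compatible families of residues
come from an element. -/
theorem exists_sub_mem_of_compatible [UniformSpace R] [IsUniformAddGroup R]
    [IsTopologicalRing R] [CompleteSpace R]
    (hbase : ∀ U ∈ 𝓝 (0 : R), ∃ I : OpenIdeal R, (I.1 : Set R) ⊆ U)
    (y : OpenIdeal R → R) (hy : ∀ I J : OpenIdeal R, I.1 ≤ J.1 → y I - y J ∈ J.1) :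
    ∃ r, ∀ I : OpenIdeal R, r - y I ∈ I.1 := by
  have : Nonempty (OpenIdeal R) := ⟨OpenIdeal.top R⟩
  have : IsCodirectedOrder (OpenIdeal R) :=
    ⟨fun I J => ⟨I.inf J, inf_le_left (a := I.1), inf_le_right (a := I.1)⟩⟩
  -- Open ideals shrink along `atBot`, so the compatible representatives form a Cauchy net.
  have hc : Cauchy (map y atBot) := by
    rw [cauchy_map_iff]
    refine ⟨inferInstance, ?_⟩
    rw [uniformity_eq_comap_nhds_zero, tendsto_comap_iff]
    intro U hU
    obtain ⟨I, hI⟩ := hbase U hU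
    rw [mem_map]
    filter_upwards [prod_mem_prod (Iic_mem_atBot I) (Iic_mem_atBot I)]
    rintro ⟨J, J'⟩ ⟨hJ, hJ'⟩
    refine hI ?_
    have := sub_mem (hy J' I hJ') (hy J I hJ)
    rwa [sub_sub_sub_cancel_right] at this
  obtain ⟨r, hr⟩ := CompleteSpace.complete hc
  refine ⟨r, fun I => ?_⟩
  have ht : Tendsto (fun J => y J - y I) atBot (𝓝 (r - y I)) :=
    (show Tendsto y atBot (𝓝 r) from hr).sub_const _
  exact I.isClosed.mem_of_tendsto ht (eventually_atBot.2 ⟨I, fun J hJ => hy J I hJ⟩)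

/-- A countable base of neighborhoods of zero contains a decreasing sequence of open ideals. -/
theorem exists_antitone_openIdeal [TopologicalSpace R]
    (hbase : ∀ U ∈ 𝓝 (0 : R), ∃ I : OpenIdeal R, (I.1 : Set R) ⊆ U)
    (hcount : (𝓝 (0 : R)).IsCountablyGenerated) (I : OpenIdeal R) :
    ∃ K : ℕ → OpenIdeal R, K 0 = I ∧ (∀ m n, m ≤ n → (K n).1 ≤ (K m).1) ∧
      ∀ J : OpenIdeal R, ∃ n, (K n).1 ≤ J.1 := by
  obtain ⟨U, hU⟩ := (𝓝 (0 : R)).exists_antitone_basis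
  choose L hL using fun n => hbase (U n) (hU.1.mem_of_mem trivial)
  let K : ℕ → OpenIdeal R := fun n => Nat.rec I (fun n J => J.inf (L n)) n
  have hK : ∀ n, (K (n + 1)).1 = (K n).1 ⊓ (L n).1 := fun n => rfl
  refine ⟨K, rfl, fun m n h => ?_, fun J => ?_⟩
  · exact antitone_nat_of_succ_le (f := fun n => (K n).1)
      (fun n => (hK n).trans_le inf_le_left) h
  · obtain ⟨n, -, hn⟩ := hU.1.mem_iff.1 (J.2.2.mem_nhds J.1.zero_mem)
    exact ⟨n + 1, (hK n).trans_le (inf_le_right.trans ((hL n).trans hn))⟩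

/-- Mittag-Leffler: along a cofinal decreasing sequence starting at the prescribed ideal, each
approximation is corrected by an element of `K n` to become right modulo the next radical;
`Ideal.radicalOver_eq_sup` supplies the correction and completeness the limit. -/
theorem liftsCompatibleFamilies_of_isCountablyGenerated [UniformSpace R] [IsUniformAddGroup R]
    [IsTopologicalRing R] [CompleteSpace R]
    (hbase : ∀ U ∈ 𝓝 (0 : R), ∃ I : OpenIdeal R, (I.1 : Set R) ⊆ U)
    (hperf : ∀ I : OpenIdeal R, IsLeftPerfect (R ⧸ I.1))
    (hcount : (𝓝 (0 : R)).IsCountablyGenerated) : LiftsCompatibleFamilies R := by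
  intro y hy I a ha
  obtain ⟨K, rfl, hK, hKJ⟩ := exists_antitone_openIdeal hbase hcount I
  have step : ∀ n r, r - y (K n) ∈ (K n).1.radicalOver →
      ∃ r', r' - y (K (n + 1)) ∈ (K (n + 1)).1.radicalOver ∧ r' - r ∈ (K n).1 := by
    intro n r hr
    have hle := hK n (n + 1) n.le_succ
    have h1 := sub_mem hr (hy _ _ hle)
    rw [sub_sub_sub_cancel_right, Ideal.radicalOver_eq_sup hle (hperf _)] at h1
    obtain ⟨u, hu, v, hv, huv⟩ := Submodule.mem_sup.1 h1
    refine ⟨r - v, ?_, ?_⟩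
    · rwa [sub_right_comm, ← huv, add_sub_cancel_right]
    · rw [sub_sub_cancel_left]; exact neg_mem hv
  choose! next hnext hnext' using step
  let s : ℕ → R := fun n => Nat.rec a (fun n r => next n r) n
  have hs : ∀ n, s n - y (K n) ∈ (K n).1.radicalOver := by
    intro n
    induction n with
    | zero => exact ha
    | succ n ih => exact hnext n _ ih
  have hss : ∀ n, s (n + 1) - s n ∈ (K n).1 := fun n => hnext' n _ (hs n)
  have hsm : ∀ m n, m ≤ n → s n - s m ∈ (K m).1 := by
    intro m n hmn
    induction n, hmn using Nat.le_induction with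
    | base => rw [sub_self]; exact zero_mem _
    | succ n hmn ih =>
      rw [← sub_add_sub_cancel _ (s n)]
      exact add_mem (hK m n hmn (hss n)) ih
  choose N hN using hKJ
  obtain ⟨r, hr⟩ := exists_sub_mem_of_compatible hbase (fun J => s (N J)) (by
    intro J J' hJ
    rcases le_total (N J) (N J') with h | h
    · rw [← neg_sub]
      exact neg_mem (((hN J).trans hJ) (hsm _ _ h))
    · exact hN J' (hsm _ _ h))
  refine ⟨r, ?_, fun J => ?_⟩
  · rw [← sub_add_sub_cancel r (s (N (K 0))) a]
    exact add_mem (hr _) (hsm 0 _ (Nat.zero_le _))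
  · rw [← sub_add_sub_cancel r (s (N J)), ← sub_add_sub_cancel (s (N J)) (y (K (N J)))]
    exact add_mem (J.1.le_radicalOver (hr J))
      (add_mem (Ideal.radicalOver_mono (hN J) (hs _)) (hy _ _ (hN J)))

/-- An element outside `limJacobson R` lies in the radical over `K m` only for `m` up to some last
`n`; subtracting an element of `limJacobson R` congruent to it modulo `K n` puts it into all these
`K m`. -/
theorem liftsNullFamilies_of_isCountablyGenerated [TopologicalSpace R]
    (hbase : ∀ U ∈ 𝓝 (0 : R), ∃ I : OpenIdeal R, (I.1 : Set R) ⊆ U)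
    (hcount : (𝓝 (0 : R)).IsCountablyGenerated) (hL : LiftsCompatibleFamilies R) :
    LiftsNullFamilies.{w} R := by
  intro X q hq
  obtain ⟨K, -, hK, hKJ⟩ := exists_antitone_openIdeal hbase hcount (OpenIdeal.top R)
  have key : ∀ z : R, ∃ b, b - z ∈ limJacobson R ∧
      ∀ m, z ∈ (K m).1.radicalOver → b ∈ (K m).1 := by
    intro z
    by_cases hz : z ∈ limJacobson R
    · exact ⟨0, by simpa using hz, fun m _ => zero_mem _⟩
    have hex : ∃ n, z ∉ (K n).1.radicalOver := by
      by_contra! h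
      refine hz (mem_limJacobson.2 fun J => ?_)
      obtain ⟨n, hn⟩ := hKJ J
      exact Ideal.radicalOver_mono hn (h n)
    classical
    have hlt : ∀ m, z ∈ (K m).1.radicalOver → m < Nat.find hex := by
      intro m hm
      by_contra! h
      exact Nat.find_spec hex (Ideal.radicalOver_mono (hK _ _ h) hm)
    rcases hn : Nat.find hex with _ | n
    · exact ⟨z, by simp, fun m hm => absurd (hlt m hm) (by omega)⟩
    · have hzn : z ∈ (K n).1.radicalOver := not_not.1 (Nat.find_min hex (by omega : n < _))
      obtain ⟨h, hh, hhz⟩ := hL.exists_sub_mem (K n) hzn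
      refine ⟨z - h, by simpa using hh, fun m hm => hK m n ?_ ?_⟩
      · have := hlt m hm
        omega
      · rw [← neg_sub]; exact neg_mem hhz
  choose a ha using key
  refine ⟨fun x => a (q x), fun x => (ha _).1, fun J => ?_⟩
  obtain ⟨n, hn⟩ := hKJ J
  exact (hq (K n)).subset fun x hx hx' => hx (hn ((ha _).2 n hx'))

/-! ### Finitely many semisimple discrete quotients -/

section Finite

variable [TopologicalSpace R] [IsTopologicalRing R]

/-- The limit radical is the intersection of the open ideals with semisimple quotient, here a finite
one. -/
theorem exists_openIdeal_eq_limJacobson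
    (hperf : ∀ I : OpenIdeal R, IsLeftPerfect (R ⧸ I.1))
    (hfin : {I : OpenIdeal R | IsSemisimpleRing (R ⧸ I.1)}.Finite) :
    ∃ N : OpenIdeal R, N.1 = limJacobson R ∧ N.1.radicalOver = N.1 := by
  have heq : (limJacobson R : Set R) =
      ⋂ I ∈ {I : OpenIdeal R | IsSemisimpleRing (R ⧸ I.1)}, (I.1 : Set R) := by
    ext x
    simp only [SetLike.mem_coe, mem_limJacobson, Set.mem_iInter, Set.mem_ofPred_eq]
    constructor
    · intro h I hI
      rw [← Ideal.radicalOver_eq_self hI]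
      exact h I
    · exact fun h I => h I.radical (I.1.isSemisimpleRing_quotient_radicalOver (hperf I))
  have hopen : IsOpen (limJacobson R : Set R) := by
    rw [heq]
    exact hfin.isOpen_biInter fun I _ => I.2.2
  refine ⟨⟨limJacobson R, inferInstance, hopen⟩, rfl, le_antisymm (fun x hx => ?_)
    (Ideal.le_radicalOver _)⟩
  refine mem_limJacobson.2 fun I => ?_
  rw [← Ideal.radicalOver_eq_self (I.1.isSemisimpleRing_quotient_radicalOver (hperf I))]
  exact Ideal.radicalOver_mono (fun z hz => mem_limJacobson.1 hz I) hx

/-- With `N` the open limit radical, the radical over any `I` is `N ⊔ I`, and the single element `y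
N` already represents the whole family modulo the radicals; only the value modulo `I` must be
adjusted. -/
theorem liftsCompatibleFamilies_of_finite
    (hperf : ∀ I : OpenIdeal R, IsLeftPerfect (R ⧸ I.1))
    (hfin : {I : OpenIdeal R | IsSemisimpleRing (R ⧸ I.1)}.Finite) :
    LiftsCompatibleFamilies R := by
  obtain ⟨N, hN, hNN⟩ := exists_openIdeal_eq_limJacobson hperf hfin
  have hNI : ∀ I : OpenIdeal R, N.1 ≤ I.1.radicalOver := fun I x hx =>
    mem_limJacobson.1 (hN ▸ hx) I
  have hrad : ∀ I : OpenIdeal R, I.1.radicalOver = N.1 ⊔ I.1 := by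
    intro I
    have h1 : (I.inf N).1.radicalOver = N.1 :=
      le_antisymm ((Ideal.radicalOver_mono (inf_le_right (a := I.1))).trans_eq hNN) (hNI _)
    have h2 := Ideal.radicalOver_eq_sup (I := (I.inf N).1) (J := I.1) inf_le_left (hperf _)
    rwa [h1] at h2
  intro y hy I a ha
  -- Both values are compared with the one at `J.inf N`.
  have hyN : ∀ J, y J - y N ∈ J.1.radicalOver := by
    intro J
    have h1 := hy (J.inf N) J (inf_le_left (a := J.1))
    have h2 := hNI J (hNN ▸ hy (J.inf N) N (inf_le_right (a := J.1)))
    rw [← sub_sub_sub_cancel_left _ _ (y (J.inf N))]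
    exact sub_mem h2 h1
  have h1 := add_mem ha (hyN I)
  rw [sub_add_sub_cancel, hrad] at h1
  obtain ⟨h, hh, i, hi, hhi⟩ := Submodule.mem_sup.1 h1
  refine ⟨a - i, by rw [sub_sub_cancel_left]; exact neg_mem hi, fun J => ?_⟩
  have h2 : a - i - y N = h := by rw [sub_right_comm, ← hhi, add_sub_cancel_right]
  rw [← sub_sub_sub_cancel_right _ _ (y N), h2]
  exact sub_mem (hNI J hh) (hyN J)

/-- All but finitely many members already lie in the open ideal `limJacobson R`, and those are
replaced by zero. -/
theorem liftsNullFamilies_of_finite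
    (hperf : ∀ I : OpenIdeal R, IsLeftPerfect (R ⧸ I.1))
    (hfin : {I : OpenIdeal R | IsSemisimpleRing (R ⧸ I.1)}.Finite) :
    LiftsNullFamilies.{w} R := by
  classical
  obtain ⟨N, hN, hNN⟩ := exists_openIdeal_eq_limJacobson hperf hfin
  intro X q hq
  refine ⟨fun x => if q x ∈ limJacobson R then 0 else q x, fun x => ?_, fun J => ?_⟩
  · dsimp only
    split_ifs with h
    · simpa using h
    · simp
  · refine (hq N).subset fun x hx hx' => hx ?_
    rw [hNN, hN] at hx'
    simp [hx']

end Finite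

end Lifting

/-! ### Topological T-nilpotency and strong closedness -/

section Radical

variable {R : Type u} [Ring R]

theorem isTopologicallyLeftTNilpotent_limJacobson [TopologicalSpace R]
    (hbase : ∀ U ∈ 𝓝 (0 : R), ∃ I : OpenIdeal R, (I.1 : Set R) ⊆ U)
    (hperf : ∀ I : OpenIdeal R, IsLeftPerfect (R ⧸ I.1)) :
    IsTopologicallyLeftTNilpotent (limJacobson R) := by
  intro a ha U hU
  obtain ⟨I, hI⟩ := hbase U hU
  obtain ⟨N, hN⟩ := (hperf I).exists_prod_eq_zero (fun n => Ideal.Quotient.mk I.1 (a n))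
    fun n => mem_limJacobson.1 (ha n) I
  rw [mem_map]
  filter_upwards [Ici_mem_atTop N] with n hn
  refine hI (Ideal.Quotient.eq_zero_iff_mem.1 ?_)
  rw [map_list_prod, List.map_map]
  -- The term of index `n` has `n + 1` factors.
  exact hN (n + 1) (Nat.le_succ_of_le hn)

theorem completeSpace_of_discreteTopology (A : Type*) [AddGroup A] [UniformSpace A]
    [IsUniformAddGroup A] [DiscreteTopology A] : CompleteSpace A := by
  have : DiscreteUniformity A := by
    rw [discreteUniformity_iff_eq_principal_setRelId, uniformity_eq_comap_nhds_zero,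
      nhds_discrete, comap_pure, principal_eq_iff_eq]
    ext ⟨x, y⟩
    simp [sub_eq_zero, eq_comm]
  infer_instance

theorem completeSpace_of_isHomeomorph {A B : Type*} [AddCommGroup A] [TopologicalSpace A]
    [IsTopologicalAddGroup A] [AddCommGroup B] [UniformSpace B] [IsUniformAddGroup B]
    [CompleteSpace B] (e : A ≃+ B) (he : IsHomeomorph e) :
    @CompleteSpace A (IsTopologicalAddGroup.rightUniformSpace A) := by
  let := IsTopologicalAddGroup.rightUniformSpace A
  have : IsUniformAddGroup A := isUniformAddGroup_of_addCommGroup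
  have h1 : UniformContinuous e := uniformContinuous_addMonoidHom_of_continuous he.continuous
  have h2 : UniformContinuous e.symm := by
    refine uniformContinuous_addMonoidHom_of_continuous ?_
    exact (Equiv.toHomeomorphOfIsInducing e.toEquiv he.isInducing).symm.continuous
  let E : A ≃ᵤ B := ⟨e.toEquiv, h1, h2⟩
  exact E.completeSpace_iff.2 inferInstance

theorem isStronglyClosed_limJacobson [TopologicalSpace R] [IsTopologicalRing R]
    (hbase : ∀ U ∈ 𝓝 (0 : R), ∃ I : OpenIdeal R, (I.1 : Set R) ⊆ U)
    (hperf : ∀ I : OpenIdeal R, IsLeftPerfect (R ⧸ I.1))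
    (hL : LiftsCompatibleFamilies R) (hN : LiftsNullFamilies.{w} R) :
    IsStronglyClosed.{w} (limJacobson R).toAddSubgroup where
  isClosed := by
    have : ((limJacobson R).toAddSubgroup : Set R) =
        ⋂ I : OpenIdeal R, (I.radical.1 : Set R) := by
      ext x
      rw [Set.mem_iInter]
      exact mem_limJacobson
    rw [this]
    exact isClosed_iInter fun I => I.radical.isClosed
  complete := by
    obtain ⟨e, he, -⟩ := exists_ringEquiv_pi_isHomeomorph hbase hperf
      (P := OpenIdeal.IsSimpleArtinian) (fun _ => Iff.rfl) hL
    have hd : ∀ G : {G : OpenIdeal R // G.IsSimpleArtinian}, DiscreteTopology (R ⧸ G.1.1) :=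
      fun G => G.1.discreteTopology
    let : ∀ G : {G : OpenIdeal R // G.IsSimpleArtinian}, UniformSpace (R ⧸ G.1.1) :=
      fun G => IsTopologicalAddGroup.rightUniformSpace _
    have : ∀ G : {G : OpenIdeal R // G.IsSimpleArtinian}, IsUniformAddGroup (R ⧸ G.1.1) :=
      fun G => isUniformAddGroup_of_addCommGroup
    have : ∀ G : {G : OpenIdeal R // G.IsSimpleArtinian}, CompleteSpace (R ⧸ G.1.1) :=
      fun G => completeSpace_of_discreteTopology _
    exact completeSpace_of_isHomeomorph (A := R ⧸ limJacobson R) e.toAddEquiv he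
  exists_lift X q hq := by
    choose z hz using fun x => QuotientAddGroup.mk_surjective (q x)
    obtain ⟨a, ha, ha0⟩ := hN X z (by
      intro I
      -- The radical over `I` is open and contains `limJacobson R`, so membership of `z x` in it
      -- depends only on `q x`, and convergence of `q` makes it hold for almost all `x`.
      have hopen : IsOpen ((QuotientAddGroup.mk : R → R ⧸ (limJacobson R).toAddSubgroup) ''
          (I.radical.1 : Set R)) := QuotientAddGroup.isOpenMap_coe _ I.radical.2.2
      have := hq (hopen.mem_nhds ⟨0, zero_mem _, rfl⟩)
      rw [mem_map, mem_cofinite] at this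
      refine this.subset fun x hx hx' => hx ?_
      obtain ⟨r, hr, hrx⟩ := hx'
      rw [← hz x, QuotientAddGroup.eq] at hrx
      have h1 : -r + z x ∈ I.1.radicalOver := mem_limJacobson.1 hrx I
      have h2 := add_mem (show r ∈ I.1.radicalOver from hr) h1
      rwa [add_neg_cancel_left] at h2)
    refine ⟨a, fun U hU => ?_, fun x => ?_⟩
    · obtain ⟨I, hI⟩ := hbase U hU
      rw [mem_map, mem_cofinite]
      exact (ha0 I).subset fun x hx hx' => hx (hI hx')
    · rw [← hz x, eq_comm, QuotientAddGroup.eq, neg_add_eq_sub]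
      exact ha x

end Radical

/-! ### Commutative rings -/

theorem IsLeftPerfect.exists_pow_mem {R : Type u} [CommRing R] {I : Ideal R}
    (h : IsLeftPerfect (R ⧸ I)) {x : R}
    (hx : x ∈ I.radicalOver) : ∃ n, x ^ n ∈ I := by
  obtain ⟨N, hN⟩ := h.exists_prod_eq_zero (fun _ => Ideal.Quotient.mk I x) fun _ => hx
  refine ⟨N, Ideal.Quotient.eq_zero_iff_mem.1 ?_⟩
  have := hN N le_rfl
  rwa [List.map_const', List.prod_replicate, List.length_range, ← map_pow] at this

/-! ### Localizations of the discrete quotients at open maximal ideals -/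

section LocalKernel

variable {R : Type u} [CommRing R] [TopologicalSpace R]

theorem OpenFieldIdeal.isMaximal (G : OpenFieldIdeal R) : G.1.1.IsMaximal :=
  Ideal.Quotient.maximal_of_isField _ G.2

theorem OpenIdeal.isField_iff_isSimpleArtinian (I : OpenIdeal R) :
    IsField (R ⧸ I.1) ↔ I.IsSimpleArtinian := by
  constructor
  · intro h
    refine ⟨(isSimpleRing_iff_isField _).2 h, ?_⟩
    let := h.toField
    exact inferInstanceAs (IsArtinianRing (R ⧸ I.1))
  · exact fun h => (isSimpleRing_iff_isField _).1 h.1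

/-- The kernel of the map from `R` to the localization of `R ⧸ I` at `G`. -/
def OpenFieldIdeal.localKernel (G : OpenFieldIdeal R) (I : Ideal R) : Ideal R where
  carrier := {r | ∃ s ∉ G.1.1, s * r ∈ I}
  zero_mem' := ⟨1, (Ideal.ne_top_iff_one _).1 G.isMaximal.ne_top, by simp⟩
  add_mem' := by
    rintro a b ⟨s, hs, hsa⟩ ⟨t, ht, htb⟩
    refine ⟨s * t, fun h => (G.isMaximal.isPrime.mem_or_mem h).elim hs ht, ?_⟩
    have : s * t * (a + b) = t * (s * a) + s * (t * b) := by ring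
    rw [this]
    exact add_mem (I.mul_mem_left _ hsa) (I.mul_mem_left _ htb)
  smul_mem' := by
    rintro c r ⟨s, hs, hsr⟩
    refine ⟨s, hs, ?_⟩
    rw [smul_eq_mul, mul_left_comm]
    exact I.mul_mem_left _ hsr

theorem OpenFieldIdeal.le_localKernel (G : OpenFieldIdeal R) (I : Ideal R) :
    I ≤ G.localKernel I := fun r hr =>
  ⟨1, (Ideal.ne_top_iff_one _).1 G.isMaximal.ne_top, by simpa using hr⟩

theorem OpenFieldIdeal.localKernel_mono (G : OpenFieldIdeal R) {I J : Ideal R} (h : I ≤ J) :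
    G.localKernel I ≤ G.localKernel J := fun _ ⟨s, hs, hsr⟩ => ⟨s, hs, h hsr⟩

theorem OpenFieldIdeal.localKernel_le (G : OpenFieldIdeal R) {I : Ideal R} (h : I ≤ G.1.1) :
    G.localKernel I ≤ G.1.1 := fun _ ⟨_, hs, hsr⟩ =>
  (G.isMaximal.isPrime.mem_or_mem (h hsr)).resolve_left hs

theorem OpenLocalIdeal.isUnit_of_notMem {G : OpenFieldIdeal R} (J : OpenLocalIdeal G) {s : R}
    (hs : s ∉ G.1.1) : IsUnit (Ideal.Quotient.mk J.1.1 s) := by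
  have := J.2.1
  obtain ⟨t, g, hg, hst⟩ := G.isMaximal.exists_inv hs
  rcases IsLocalRing.isUnit_or_isUnit_of_add_one
    (a := Ideal.Quotient.mk J.1.1 (t * s)) (b := Ideal.Quotient.mk J.1.1 g)
    (by rw [← map_add, hst, map_one]) with h | h
  · rw [map_mul] at h
    exact isUnit_of_mul_isUnit_right h
  · exfalso
    have h2 := h.map (Ideal.Quotient.factor J.2.2)
    rw [Ideal.Quotient.factor_mk, Ideal.Quotient.eq_zero_iff_mem.2 hg] at h2
    have : Nontrivial (R ⧸ G.1.1) := Ideal.Quotient.nontrivial_iff.2 G.isMaximal.ne_top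
    exact not_isUnit_zero h2

theorem OpenLocalIdeal.localKernel_le {G : OpenFieldIdeal R} (J : OpenLocalIdeal G) :
    G.localKernel J.1.1 ≤ J.1.1 := by
  rintro r ⟨s, hs, hsr⟩
  rw [← Ideal.Quotient.eq_zero_iff_mem, map_mul] at hsr
  exact Ideal.Quotient.eq_zero_iff_mem.1 ((J.isUnit_of_notMem hs).mul_right_eq_zero.1 hsr)

theorem LocalPiece.isUnit_of_ne_zero {G : OpenFieldIdeal R} (x : LocalPiece G)
    (hx : x.1 (OpenLocalIdeal.self G) ≠ 0) : IsUnit x := by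
  have hu : ∀ J : OpenLocalIdeal G, IsUnit (x.1 J) := by
    intro J
    obtain ⟨s, hs⟩ := Ideal.Quotient.mk_surjective (x.1 J)
    rw [← hs]
    refine J.isUnit_of_notMem fun h => hx ?_
    refine (x.2 J (OpenLocalIdeal.self G) J.2.2).symm.trans ?_
    rw [← hs]
    exact Ideal.Quotient.eq_zero_iff_mem.2 h
  choose y hy using fun J => (hu J).exists_right_inv
  -- Uniqueness of inverses makes the coordinatewise inverses compatible.
  have hymem : y ∈ LocalPiece G := by
    intro J J' h
    refine left_inv_eq_right_inv (a := x.1 J') ?_ (hy J')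
    rw [← x.2 J J' h, ← map_mul, mul_comm, hy, map_one]
  exact IsUnit.of_mul_eq_one ⟨y, hymem⟩ (Subtype.ext (funext hy))

theorem LocalPiece.isLocalRing (G : OpenFieldIdeal R) : IsLocalRing (LocalPiece G) := by
  have hG : Nontrivial (R ⧸ G.1.1) := Ideal.Quotient.nontrivial_iff.2 G.isMaximal.ne_top
  have : Nontrivial (LocalPiece G) := by
    refine ⟨0, 1, fun h => ?_⟩
    have h1 := congr_fun (congr_arg Subtype.val h) (OpenLocalIdeal.self G)
    exact zero_ne_one (α := R ⧸ G.1.1) h1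
  refine ⟨fun {a b} hab => ?_⟩
  by_cases ha : a.1 (OpenLocalIdeal.self G) = 0
  · right
    refine LocalPiece.isUnit_of_ne_zero b fun hb => ?_
    have h1 := congr_fun (congr_arg Subtype.val hab) (OpenLocalIdeal.self G)
    have h2 : a.1 (OpenLocalIdeal.self G) + b.1 (OpenLocalIdeal.self G) = 1 := h1
    rw [ha, hb, add_zero] at h2
    exact zero_ne_one (α := R ⧸ G.1.1) h2
  · exact Or.inl (LocalPiece.isUnit_of_ne_zero a ha)

section Perfect

variable [IsTopologicalRing R]

/-- A maximal ideal containing an open ideal, as an open ideal whose quotient is a field. -/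
def OpenIdeal.fieldIdealOfIsMaximal (I : OpenIdeal R) {m : Ideal R} (hm : m.IsMaximal)
    (h : I.1 ≤ m) : OpenFieldIdeal R :=
  ⟨⟨m, inferInstance, I.isOpen_of_le h⟩, (Ideal.Quotient.maximal_ideal_iff_isField_quotient m).1 hm⟩

/-- Local-global principle: if the conductor `A` of `r` into `I` were proper, it would lie in a
maximal ideal, which is open because it contains `I`. -/
theorem OpenIdeal.mem_of_forall_mem_localKernel (I : OpenIdeal R) {r : R}
    (h : ∀ G : OpenFieldIdeal R, I.1 ≤ G.1.1 → r ∈ G.localKernel I.1) : r ∈ I.1 := by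
  by_contra hr
  let A : Ideal R := Submodule.comap (LinearMap.toSpanSingleton R R r) I.1
  have hA : ∀ s, s ∈ A ↔ s * r ∈ I.1 := fun s => by
    rw [Submodule.mem_comap, LinearMap.toSpanSingleton_apply, smul_eq_mul]
  have hne : A ≠ ⊤ := fun h' => hr (by
    have := (hA 1).1 ((Ideal.eq_top_iff_one _).1 h')
    rwa [one_mul] at this)
  obtain ⟨m, hm, hle⟩ := Ideal.exists_le_maximal _ hne
  have hI : I.1 ≤ m := fun s hs => hle ((hA s).2 (I.1.mul_mem_right _ hs))
  obtain ⟨s, hs, hsr⟩ := h (I.fieldIdealOfIsMaximal hm hI) hI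
  exact hs (hle ((hA s).2 hsr))

/-- Localizing `R ⧸ I` at `G` needs no denominators. Take `u` equal to `1` modulo `G` and `0` modulo
the other maximal ideals over `I`: then `u * (u - 1)` is nilpotent modulo `I`, so a power of `u - 1`
dies in the localization. Another maximal ideal containing the kernel would contain both `u` and `u
- 1`. -/
theorem OpenFieldIdeal.isUnit_mk_localKernel
    (hperf : ∀ I : OpenIdeal R, IsLeftPerfect (R ⧸ I.1)) (G : OpenFieldIdeal R) (I : OpenIdeal R)
    {s : R} (hs : s ∉ G.1.1) : IsUnit (Ideal.Quotient.mk (G.localKernel I.1) s) := by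
  classical
  by_contra hu
  have hne : G.localKernel I.1 ⊔ Ideal.span {s} ≠ ⊤ := by
    intro h
    obtain ⟨k, hk, t, ht, hkt⟩ := Submodule.mem_sup.1 ((Ideal.eq_top_iff_one _).1 h)
    obtain ⟨t, rfl⟩ := Ideal.mem_span_singleton.1 ht
    refine hu (IsUnit.of_mul_eq_one (Ideal.Quotient.mk _ t) ?_)
    rw [← map_mul, ← map_one (Ideal.Quotient.mk _), ← hkt, map_add,
      Ideal.Quotient.eq_zero_iff_mem.2 hk, zero_add]
  obtain ⟨m, hm, hle⟩ := Ideal.exists_le_maximal _ hne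
  have hIm : I.1 ≤ m := (G.le_localKernel I.1).trans (le_sup_left.trans hle)
  let M := I.fieldIdealOfIsMaximal hm hIm
  have hMG : M ≠ G := by
    intro h
    refine hs ?_
    rw [← h]
    exact hle (le_sup_right (a := G.localKernel I.1) (Ideal.mem_span_singleton_self s))
  -- `G` is not assumed to contain `I`; intersecting with it brings `G` among the ideals controlled.
  obtain ⟨u, hu⟩ := (I.inf G.1).exists_sub_mem hperf OpenIdeal.isField_iff_isSimpleArtinian
    fun G' => if G' = G then 1 else 0
  have huG : u - 1 ∈ G.1.1 := by simpa using hu G inf_le_right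
  have huM : ∀ G' : OpenFieldIdeal R, I.1 ≤ G'.1.1 → G' ≠ G → u ∈ G'.1.1 := by
    intro G' hG' hne
    simpa [hne] using hu G' (inf_le_left.trans hG')
  have hrad : u * (u - 1) ∈ I.1.radicalOver := by
    refine (I.mem_radicalOver_iff hperf OpenIdeal.isField_iff_isSimpleArtinian).2 fun G' hG' => ?_
    by_cases h : G' = G
    · subst h; exact Ideal.mul_mem_left _ _ huG
    · exact Ideal.mul_mem_right _ _ (huM G' hG' h)
  obtain ⟨n, hn⟩ := (hperf I).exists_pow_mem hrad
  rw [mul_pow] at hn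
  have hone : ∀ G' : OpenFieldIdeal R, u ∈ G'.1.1 → u - 1 ∉ G'.1.1 := by
    intro G' h1 h2
    have := sub_mem h1 h2
    rw [sub_sub_cancel] at this
    exact (Ideal.ne_top_iff_one _).1 G'.isMaximal.ne_top this
  have huk : (u - 1) ^ n ∈ G.localKernel I.1 :=
    ⟨u ^ n, fun h => hone G (G.isMaximal.isPrime.mem_of_pow_mem _ h) huG, hn⟩
  exact hone M (huM M hIm hMG) (hm.isPrime.mem_of_pow_mem _
    (hle (le_sup_left (b := Ideal.span {s}) huk)))

theorem OpenFieldIdeal.le_of_localKernel_le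
    (hperf : ∀ I : OpenIdeal R, IsLeftPerfect (R ⧸ I.1)) (G : OpenFieldIdeal R) (I : OpenIdeal R)
    {m : Ideal R} (hm : m ≠ ⊤) (h : G.localKernel I.1 ≤ m) : m ≤ G.1.1 := by
  intro s hs
  by_contra hsG
  have h1 := (G.isUnit_mk_localKernel hperf I hsG).map (Ideal.Quotient.factor h)
  rw [Ideal.Quotient.factor_mk, Ideal.Quotient.eq_zero_iff_mem.2 hs] at h1
  have : Nontrivial (R ⧸ m) := Ideal.Quotient.nontrivial_iff.2 hm
  exact not_isUnit_zero h1

theorem OpenFieldIdeal.localKernel_sup_eq_top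
    (hperf : ∀ I : OpenIdeal R, IsLeftPerfect (R ⧸ I.1)) {G G' : OpenFieldIdeal R} (hne : G ≠ G')
    (I : OpenIdeal R) : G.localKernel I.1 ⊔ G'.localKernel I.1 = ⊤ := by
  by_contra htop
  obtain ⟨m, hm, hle⟩ := Ideal.exists_le_maximal _ htop
  have h1 := G.le_of_localKernel_le hperf I hm.ne_top (le_sup_left.trans hle)
  have h2 := G'.le_of_localKernel_le hperf I hm.ne_top (le_sup_right.trans hle)
  exact hne (Subtype.ext (Subtype.ext ((hm.eq_of_le G.isMaximal.ne_top h1).symm.trans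
    (hm.eq_of_le G'.isMaximal.ne_top h2))))

/-- The quotient of `R ⧸ I` that is its localization at `G`. -/
def OpenFieldIdeal.localIdeal (hperf : ∀ I : OpenIdeal R, IsLeftPerfect (R ⧸ I.1))
    (G : OpenFieldIdeal R) (I : OpenIdeal R) (h : I.1 ≤ G.1.1) : OpenLocalIdeal G :=
  ⟨⟨G.localKernel I.1, inferInstance, I.isOpen_of_le (G.le_localKernel I.1)⟩, by
    have hle := G.localKernel_le h
    have : Nontrivial (R ⧸ G.localKernel I.1) := Ideal.Quotient.nontrivial_iff.2
      fun h' => G.isMaximal.ne_top (top_le_iff.1 (h' ▸ hle))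
    refine ⟨⟨fun {a b} hab => ?_⟩, hle⟩
    obtain ⟨a, rfl⟩ := Ideal.Quotient.mk_surjective a
    obtain ⟨b, rfl⟩ := Ideal.Quotient.mk_surjective b
    by_cases ha : a ∈ G.1.1
    · refine Or.inr (G.isUnit_mk_localKernel hperf I fun hb => ?_)
      rw [← map_add, ← map_one (Ideal.Quotient.mk _), Ideal.Quotient.eq] at hab
      have h1 := sub_mem (add_mem ha hb) (hle hab)
      rw [sub_sub_cancel] at h1
      exact (Ideal.ne_top_iff_one _).1 G.isMaximal.ne_top h1
    · exact Or.inl (G.isUnit_mk_localKernel hperf I ha)⟩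

theorem OpenIdeal.mem_of_toLocalPiece (hperf : ∀ I : OpenIdeal R, IsLeftPerfect (R ⧸ I.1))
    (I : OpenIdeal R) {r : R}
    (h : ∀ (G : OpenFieldIdeal R) (hG : I.1 ≤ G.1.1),
      (toLocalPiece G r).1 (G.localIdeal hperf I hG) = 0) : r ∈ I.1 :=
  I.mem_of_forall_mem_localKernel fun G hG => Ideal.Quotient.eq_zero_iff_mem.1 (h G hG)

/-- A family of elements of the local rings comes, modulo an open ideal, from an element. -/
theorem OpenIdeal.exists_toLocalPiece_eq (hperf : ∀ I : OpenIdeal R, IsLeftPerfect (R ⧸ I.1))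
    (I : OpenIdeal R) (x : ∀ G : OpenFieldIdeal R, LocalPiece G) :
    ∃ r, ∀ (G : OpenFieldIdeal R) (J : OpenLocalIdeal G), I.1 ≤ J.1.1 →
      (toLocalPiece G r).1 J = (x G).1 J := by
  have hfin := I.finite_ge hperf OpenIdeal.isField_iff_isSimpleArtinian
  have : Fintype {G : OpenFieldIdeal R // I.1 ≤ G.1.1} := hfin.fintype
  choose z hz using fun G : {G : OpenFieldIdeal R // I.1 ≤ G.1.1} =>
    Ideal.Quotient.mk_surjective ((x G.1).1 (G.1.localIdeal hperf I G.2))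
  obtain ⟨r, hr⟩ := Ideal.exists_sub_mem_of_pairwise_sup_eq_top
    (fun G : {G : OpenFieldIdeal R // I.1 ≤ G.1.1} => G.1.localKernel I.1)
    (fun G G' h => OpenFieldIdeal.localKernel_sup_eq_top hperf (fun h' => h (Subtype.ext h')) I)
    Finset.univ z
  refine ⟨r, fun G J hJ => ?_⟩
  have hG : I.1 ≤ G.1.1 := hJ.trans J.2.2
  -- Every local quotient of `R ⧸ I` at `G` factors through its localization, so agreement there
  -- implies agreement at `J`.
  have hle : G.localKernel I.1 ≤ J.1.1 := (G.localKernel_mono hJ).trans J.localKernel_le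
  have h1 : Ideal.Quotient.mk (G.localKernel I.1) r = (x G).1 (G.localIdeal hperf I hG) :=
    (Ideal.Quotient.eq.2 (hr ⟨G, hG⟩ (Finset.mem_univ _))).trans (hz ⟨G, hG⟩)
  rw [← (x G).2 (G.localIdeal hperf I hG) J hle, ← h1]
  rfl

end Perfect

end LocalKernel

/-! ### Decomposition of a commutative ring into local factors -/

section Decomposition

variable {R : Type u} [CommRing R]

/-- Solutions modulo each `I` exist by the Chinese remainder theorem and are unique modulo `I`,
hence compatible; completeness glues them. -/
theorem toLocalPieces_surjective [UniformSpace R] [IsUniformAddGroup R]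
    [IsTopologicalRing R] [CompleteSpace R]
    (hbase : ∀ U ∈ 𝓝 (0 : R), ∃ I : OpenIdeal R, (I.1 : Set R) ⊆ U)
    (hperf : ∀ I : OpenIdeal R, IsLeftPerfect (R ⧸ I.1)) :
    Function.Surjective (toLocalPieces R) := by
  intro x
  choose y hy using fun I : OpenIdeal R => I.exists_toLocalPiece_eq hperf x
  obtain ⟨r, hr⟩ := exists_sub_mem_of_compatible hbase y fun I I' hI =>
    I'.mem_of_toLocalPiece hperf fun G hG => by
      have hle : I'.1 ≤ (G.localIdeal hperf I' hG).1.1 := G.le_localKernel I'.1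
      rw [map_sub]
      exact sub_eq_zero.2 ((hy I G _ (hI.trans hle)).trans (hy I' G _ hle).symm)
  refine ⟨r, funext fun G => Subtype.ext (funext fun J => ?_)⟩
  exact (Ideal.Quotient.eq.2 (hr J.1)).trans (hy J.1 G J le_rfl)

theorem continuous_toLocalPieces [TopologicalSpace R] : Continuous (toLocalPieces R) :=
  continuous_pi fun _ => Continuous.subtype_mk (continuous_pi fun _ => continuous_quot_mk) _

variable [TopologicalSpace R] [IsTopologicalRing R]

theorem toLocalPieces_injective [T2Space R]
    (hbase : ∀ U ∈ 𝓝 (0 : R), ∃ I : OpenIdeal R, (I.1 : Set R) ⊆ U)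
    (hperf : ∀ I : OpenIdeal R, IsLeftPerfect (R ⧸ I.1)) :
    Function.Injective (toLocalPieces R) := by
  refine (injective_iff_map_eq_zero _).2 fun r hr => ?_
  by_contra hne
  obtain ⟨I, hI⟩ := hbase {r}ᶜ (isOpen_compl_singleton.mem_nhds (Ne.symm hne))
  refine hI (I.mem_of_toLocalPiece hperf fun G hG => ?_) rfl
  have h1 : toLocalPiece G r = 0 := congr_fun hr G
  rw [h1]
  rfl

theorem isOpenMap_toLocalPieces
    (hbase : ∀ U ∈ 𝓝 (0 : R), ∃ I : OpenIdeal R, (I.1 : Set R) ⊆ U)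
    (hperf : ∀ I : OpenIdeal R, IsLeftPerfect (R ⧸ I.1))
    (hs : Function.Surjective (toLocalPieces R)) : IsOpenMap (toLocalPieces R) := by
  refine AddMonoidHom.isOpenMap_of_image_mem_nhds (toLocalPieces R).toAddMonoidHom fun U hU => ?_
  obtain ⟨I, hI⟩ := hbase U hU
  have key : ∀ G : OpenFieldIdeal R, ∀ᶠ x in 𝓝 (0 : ∀ G : OpenFieldIdeal R, LocalPiece G),
      ∀ hG : I.1 ≤ G.1.1, (x G).1 (G.localIdeal hperf I hG) = 0 := by
    intro G
    by_cases hG : I.1 ≤ G.1.1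
    · let J := G.localIdeal hperf I hG
      have := J.1.discreteTopology
      have hc : Continuous fun x : ∀ G : OpenFieldIdeal R, LocalPiece G => (x G).1 J :=
        (continuous_apply J).comp (continuous_subtype_val.comp (continuous_apply G))
      filter_upwards [(isOpen_discrete {(0 : R ⧸ J.1.1)}).preimage hc |>.mem_nhds rfl] with x hx _
      exact hx
    · exact Eventually.of_forall fun x h => absurd h hG
  have hev := (eventually_all_finite
    (I.finite_ge hperf OpenIdeal.isField_iff_isSimpleArtinian)).2 fun G _ => key G
  filter_upwards [hev] with x hx
  obtain ⟨r, rfl⟩ := hs x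
  exact ⟨r, hI (I.mem_of_toLocalPiece hperf fun G hG => hx G hG hG), rfl⟩

theorem mem_limJacobson_iff_forall_mem_openFieldIdeal
    (hperf : ∀ I : OpenIdeal R, IsLeftPerfect (R ⧸ I.1)) {x : R} :
    x ∈ limJacobson R ↔ ∀ G : OpenFieldIdeal R, x ∈ G.1.1 :=
  mem_limJacobson_iff_forall_mem hperf OpenIdeal.isField_iff_isSimpleArtinian

theorem toLocalPieces_image_limJacobson
    (hperf : ∀ I : OpenIdeal R, IsLeftPerfect (R ⧸ I.1))
    (hs : Function.Surjective (toLocalPieces R)) :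
    toLocalPieces R '' (limJacobson R : Set R) =
      Set.pi Set.univ (fun G => (LocalPiece.residueKernel G : Set (LocalPiece G))) := by
  have h : ∀ r (G : OpenFieldIdeal R),
      toLocalPieces R r G ∈ LocalPiece.residueKernel G ↔ r ∈ G.1.1 :=
    fun r G => RingHom.mem_ker.trans Ideal.Quotient.eq_zero_iff_mem
  ext x
  obtain ⟨r, rfl⟩ := hs x
  constructor
  · rintro ⟨s, hs, hsr⟩ G -
    rw [← hsr]
    exact (h s G).2 ((mem_limJacobson_iff_forall_mem_openFieldIdeal hperf).1 hs G)
  · intro hx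
    exact ⟨r, (mem_limJacobson_iff_forall_mem_openFieldIdeal hperf).2
      fun G => (h r G).1 (hx G trivial), rfl⟩

/-- The components of `r` may be chosen independently: `a` at those `G` containing `I`, the value `y
G` at all others. -/
theorem liftsCompatibleFamilies_of_surjective
    (hperf : ∀ I : OpenIdeal R, IsLeftPerfect (R ⧸ I.1))
    (hs : Function.Surjective (toLocalPieces R)) : LiftsCompatibleFamilies R := by
  classical
  intro y hy I a ha
  obtain ⟨r, hr⟩ := hs fun G => toLocalPiece G (if I.1 ≤ G.1.1 then a else y G.1)
  have hrG : ∀ G : OpenFieldIdeal R, toLocalPiece G r =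
      toLocalPiece G (if I.1 ≤ G.1.1 then a else y G.1) := fun G => congr_fun hr G
  have hyG : ∀ (J : OpenIdeal R) (G : OpenFieldIdeal R), J.1 ≤ G.1.1 →
      y J - y G.1 ∈ G.1.1 := by
    intro J G hG
    have := hy J G.1 hG
    rwa [((OpenIdeal.isField_iff_isSimpleArtinian _).1 G.2).radicalOver_eq] at this
  refine ⟨r, I.mem_of_toLocalPiece hperf fun G hG => ?_, fun J => ?_⟩
  · rw [map_sub, hrG, if_pos hG, sub_self]
    rfl
  · refine (J.mem_radicalOver_iff hperf OpenIdeal.isField_iff_isSimpleArtinian).2 fun G hG => ?_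
    have h1 : r - (if I.1 ≤ G.1.1 then a else y G.1) ∈ G.1.1 :=
      Ideal.Quotient.eq.1 (congr_fun (congr_arg Subtype.val (hrG G)) (OpenLocalIdeal.self G))
    have h2 : (if I.1 ≤ G.1.1 then a else y G.1) - y G.1 ∈ G.1.1 := by
      split_ifs with hI
      · rw [← sub_add_sub_cancel a (y I)]
        exact add_mem ((I.mem_radicalOver_iff hperf OpenIdeal.isField_iff_isSimpleArtinian).1 ha
          G hI) (hyG I G hI)
      · rw [sub_self]; exact zero_mem _
    have h3 := sub_mem (add_mem h1 h2) (hyG J G hG)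
    rwa [sub_add_sub_cancel, sub_sub_sub_cancel_right] at h3

/-- Replacing by zero each component of `q x` that lies in the maximal ideal changes nothing modulo
any `G`, and kills all components over `I` once `q x` is in the radical over `I`. -/
theorem liftsNullFamilies_of_surjective
    (hperf : ∀ I : OpenIdeal R, IsLeftPerfect (R ⧸ I.1))
    (hs : Function.Surjective (toLocalPieces R)) : LiftsNullFamilies.{w} R := by
  classical
  intro X q hq
  choose a ha using fun x => hs fun G => toLocalPiece G (if q x ∈ G.1.1 then 0 else q x)
  have haG : ∀ x (G : OpenFieldIdeal R), toLocalPiece G (a x) =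
      toLocalPiece G (if q x ∈ G.1.1 then 0 else q x) := fun x G => congr_fun (ha x) G
  refine ⟨a, fun x => ?_, fun I => (hq I).subset fun x hx hqx => hx ?_⟩
  · refine (mem_limJacobson_iff_forall_mem_openFieldIdeal hperf).2 fun G => ?_
    have h1 : a x - (if q x ∈ G.1.1 then 0 else q x) ∈ G.1.1 :=
      Ideal.Quotient.eq.1 (congr_fun (congr_arg Subtype.val (haG x G)) (OpenLocalIdeal.self G))
    split_ifs at h1 with hG
    · rw [sub_zero] at h1
      exact sub_mem h1 hG
    · exact h1
  · refine I.mem_of_toLocalPiece hperf fun G hG => ?_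
    rw [haG, if_pos ((I.mem_radicalOver_iff hperf OpenIdeal.isField_iff_isSimpleArtinian).1 hqx
      G hG), map_zero]
    rfl

end Decomposition

/-! ### The commutative case assembled and the main theorem -/

section Main

theorem commutative_decomposition {R : Type u} [CommRing R] [UniformSpace R] [IsUniformAddGroup R]
    [IsTopologicalRing R] [T2Space R] [CompleteSpace R]
    (hbase : ∀ U ∈ 𝓝 (0 : R), ∃ I : OpenIdeal R, (I.1 : Set R) ⊆ U)
    (hperf : ∀ I : OpenIdeal R, IsLeftPerfect (R ⧸ I.1)) :
    LiftsCompatibleFamilies R ∧ LiftsNullFamilies.{w} R ∧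
    (∀ G : OpenFieldIdeal R, IsLocalRing (LocalPiece G)) ∧
    IsHomeomorph (toLocalPieces R) ∧
    toLocalPieces R '' (limJacobson R : Set R) =
      Set.pi Set.univ (fun G => (LocalPiece.residueKernel G : Set (LocalPiece G))) ∧
    ∃ e : (R ⧸ limJacobson R) ≃+* (∀ G : OpenFieldIdeal R, R ⧸ G.1.1),
      IsHomeomorph e ∧ ∀ r G, e (Ideal.Quotient.mk _ r) G = Ideal.Quotient.mk G.1.1 r := by
  have hs := toLocalPieces_surjective hbase hperf
  have hL := liftsCompatibleFamilies_of_surjective hperf hs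
  exact ⟨hL, liftsNullFamilies_of_surjective hperf hs, LocalPiece.isLocalRing,
    ⟨continuous_toLocalPieces, isOpenMap_toLocalPieces hbase hperf hs,
      toLocalPieces_injective hbase hperf, hs⟩,
    toLocalPieces_image_limJacobson hperf hs,
    exists_ringEquiv_pi_isHomeomorph hbase hperf OpenIdeal.isField_iff_isSimpleArtinian hL⟩

end Main
theorem proposition10p2 {R : Type u} [Ring R] [UniformSpace R] [IsUniformAddGroup R]
    [IsTopologicalRing R] [T2Space R] [CompleteSpace R]
    -- open two-sided ideals form a base of neighborhoods of zero
    (hbase : ∀ U ∈ 𝓝 (0 : R), ∃ I : OpenIdeal R, (I.1 : Set R) ⊆ U)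
    -- all discrete quotient rings are left perfect
    (hperf : ∀ I : OpenIdeal R, IsLeftPerfect (R ⧸ I.1))
    -- (a) `R` is commutative, or (b) `R` has a countable base of neighborhoods of zero, or
    -- (c) `R` has only finitely many semisimple Artinian discrete quotient rings
    (habc : (∀ x y : R, x * y = y * x) ∨ (𝓝 (0 : R)).IsCountablyGenerated ∨
      {I : OpenIdeal R | IsSemisimpleRing (R ⧸ I.1)}.Finite) :
    (limJacobson R).IsTwoSided ∧
    IsTopologicallyLeftTNilpotent (limJacobson R) ∧
    IsStronglyClosed.{w} (limJacobson R).toAddSubgroup ∧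
    (∃ (Γ : Type u) (S : Γ → Type u) (_ : ∀ γ, Ring (S γ)) (_ : ∀ γ, TopologicalSpace (S γ)),
      (∀ γ, DiscreteTopology (S γ) ∧ IsSimpleRing (S γ) ∧ IsArtinianRing (S γ)) ∧
      ∃ e : (R ⧸ limJacobson R) ≃+* (∀ γ, S γ), IsHomeomorph e) ∧
    -- the decomposition in the commutative case
    ((∀ x y : R, x * y = y * x) →
      (∀ G : OpenFieldIdeal R, IsLocalRing (LocalPiece G)) ∧
      IsHomeomorph (toLocalPieces R) ∧
      toLocalPieces R '' (limJacobson R : Set R) =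
        Set.pi Set.univ (fun G => (LocalPiece.residueKernel G : Set (LocalPiece G))) ∧
      ∃ e : (R ⧸ limJacobson R) ≃+* (∀ G : OpenFieldIdeal R, R ⧸ G.1.1),
        IsHomeomorph e ∧ ∀ r G, e (Ideal.Quotient.mk _ r) G = Ideal.Quotient.mk G.1.1 r) := by
  have hcomm : (∀ x y : R, x * y = y * x) →
      LiftsCompatibleFamilies R ∧ LiftsNullFamilies.{w} R ∧
      (∀ G : OpenFieldIdeal R, IsLocalRing (LocalPiece G)) ∧
      IsHomeomorph (toLocalPieces R) ∧
      toLocalPieces R '' (limJacobson R : Set R) =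
        Set.pi Set.univ (fun G => (LocalPiece.residueKernel G : Set (LocalPiece G))) ∧
      ∃ e : (R ⧸ limJacobson R) ≃+* (∀ G : OpenFieldIdeal R, R ⧸ G.1.1),
        IsHomeomorph e ∧ ∀ r G, e (Ideal.Quotient.mk _ r) G = Ideal.Quotient.mk G.1.1 r := by
    intro h
    -- The structure extends the given ring, so ideals, quotients and limits remain the same
    -- objects.
    let _ : CommRing R := { ‹Ring R› with mul_comm := h }
    exact commutative_decomposition hbase hperf
  obtain ⟨hL, hN⟩ : LiftsCompatibleFamilies R ∧ LiftsNullFamilies.{w} R := by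
    rcases habc with h | h | h
    · exact ⟨(hcomm h).1, (hcomm h).2.1⟩
    · have hL := liftsCompatibleFamilies_of_isCountablyGenerated hbase hperf h
      exact ⟨hL, liftsNullFamilies_of_isCountablyGenerated hbase h hL⟩
    · exact ⟨liftsCompatibleFamilies_of_finite hperf h, liftsNullFamilies_of_finite hperf h⟩
  refine ⟨inferInstance, isTopologicallyLeftTNilpotent_limJacobson hbase hperf,
    isStronglyClosed_limJacobson hbase hperf hL hN, ?_, fun h => (hcomm h).2.2⟩
  obtain ⟨e, he, -⟩ := exists_ringEquiv_pi_isHomeomorph hbase hperf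
    (P := OpenIdeal.IsSimpleArtinian) (fun _ => Iff.rfl) hL
  exact ⟨{G : OpenIdeal R // G.IsSimpleArtinian}, fun G => R ⧸ G.1.1, inferInstance, inferInstance,
    fun G => ⟨G.1.discreteTopology, G.2⟩, e, he⟩
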